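/- In the binary model there are $m$ options. Option $i$ is feasible with known probability $p_i\in(0,1]$, independently of the others; examining it (which reveals whether it is feasible) costs $c_i\ge 0$; if feasible it is worth $x_i$ to the principal and $y_i$ to the agent, and if infeasible it is worth $0$ to both. It is assumed that $c_i\le p_iy_i$ for all $i$. A search strategy examines options adaptively, one at a time, and finally stops. At most $n$ options may be examined. Let $\mathrm{OPT}_n$ be the supremum, over all such strategies in which the principal searches herself and on stopping claims at most one examined option, of the expected value $x_i$ of the claimed option if feasible ($0$ otherwise) minus the total cost of the examined options. In delegated search the agent examines at most $n$ options, pays for them, and proposes at most one option. The single-proposal mechanism with eligible set $R\subseteq\{1,\dots,m\}$ accepts the proposal if and only if it lies in $R$. If the accepted option $i$ is feasible and was examined, the principal gets $x_i$ and the agent $y_i$; both get $0$ if it was examined and is infeasible, or if nothing is accepted; if it was not examined, the principal gets $0$ and the agent $-1$. The examination costs are subtracted from both utilities. Say that $R$ *attains the fraction* $\rho$ if, for every ordering of $R$ by non-increasing $w_i=y_i-c_i/p_i$ (ties in any way), examining $R$ in this order and stopping with the proposal of the first feasible option (with no proposal if there is none) is a best response of the agent, i.e. it maximizes his expected net utility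 among all strategies that examine at most $n$ options, and with this response the expected net utility of the principal is at least $\rho\cdot\mathrm{OPT}_n$. **Theorem.** (1) For every instance of the binary model and every $n\ge 0$ there is a set $R$ that attains the fraction $\frac12\left(1-\frac1e\right)$. (2) There is an algorithm that, given an instance with rational data, $n$, and a rational $\varepsilon>0$, computes, in time polynomial in the bit length of the input and in $1/\varepsilon$, a set $R$ that attains the fraction $\frac12\left(1-\frac1e-\varepsilon\right)$, listed in non-increasing order of $w_i$ (so that a best response of the agent is computed as well). -/

import Mathlib

namespace DelegatedSearch

/-! ### The binary model -/

/-- An instance of the binary model with options `0, …, m - 1`: option `i` is feasible with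
probability `p i`, independently of the other options; finding out costs `c i`; if feasible it is
worth `x i` to the principal and `y i` to the agent (and `0` to both otherwise). -/
structure Instance (m : ℕ) where
  p : Fin m → ℝ
  c : Fin m → ℝ
  x : Fin m → ℝ
  y : Fin m → ℝ
  p_pos : ∀ i, 0 < p i
  p_le_one : ∀ i, p i ≤ 1
  c_nonneg : ∀ i, 0 ≤ c i
  c_le : ∀ i, c i ≤ p i * y i

/-- A realization says which options are feasible. -/
abbrev Realization (m : ℕ) : Type := Fin m → Bool

/-- Expectation over the realization, the options being feasible independently. -/
noncomputable def Instance.expect {m : ℕ} (I : Instance m) (f : Realization m → ℝ) : ℝ :=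
  ∑ b : Realization m, (∏ i, if b i then I.p i else 1 - I.p i) * f b

/-- An adaptive search strategy: a decision tree that examines options one at a time, branches on
whether the examined option is feasible, and eventually halts with some `a : α` (the option to
claim, or the signal to send). -/
inductive Strategy (m : ℕ) (α : Type) : Type where
  | halt (a : α) : Strategy m α
  | explore (i : Fin m) (ifInfeasible ifFeasible : Strategy m α) : Strategy m α

/-- The set of options examined under the realization `b`. -/
def Strategy.explored {m : ℕ} {α : Type} : Strategy m α → Realization m → Finset (Fin m)
  | .halt _, _ => ∅
  | .explore i s t, b => insert i (if b i then t.explored b else s.explored b)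

/-- What the strategy halts with under the realization `b`. -/
def Strategy.result {m : ℕ} {α : Type} : Strategy m α → Realization m → α
  | .halt a, _ => a
  | .explore i s t, b => if b i then t.result b else s.result b

/-- The strategy never examines more than `n` options. -/
def Strategy.WithinBudget {m : ℕ} {α : Type} (n : ℕ) (s : Strategy m α) : Prop :=
  ∀ b, (s.explored b).card ≤ n

/-- The principal's utility when the options in `S` were examined, and the outcome is `o`
(`none` is the null outcome): an outcome that was not examined, or is infeasible, is worth `0`;
the search costs are deducted. -/
noncomputable def Instance.principalUtility {m : ℕ} (I : Instance m) (b : Realization m)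
    (S : Finset (Fin m)) (o : Option (Fin m)) : ℝ :=
  (match o with
    | none => 0
    | some i => if i ∈ S ∧ b i = true then I.x i else 0) - ∑ i ∈ S, I.c i

/-- The agent's utility when he examined the options in `S`, and the outcome is `o`: he suffers a
penalty of `1` if the outcome is an option that he has not examined; he pays the search costs. -/
noncomputable def Instance.agentUtility {m : ℕ} (I : Instance m) (b : Realization m)
    (S : Finset (Fin m)) (o : Option (Fin m)) : ℝ :=
  (match o with
    | none => 0
    | some i => if i ∈ S then (if b i then I.y i else 0) else -1) - ∑ i ∈ S, I.c i

/-- The expected net value to the principal of a search that she performs herself, where the search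
ends with the option that she claims, if any. -/
noncomputable def Instance.searchValue {m : ℕ} (I : Instance m)
    (s : Strategy m (Option (Fin m))) : ℝ :=
  I.expect fun b => I.principalUtility b (s.explored b) (s.result b)

/-- The expected net value of the optimal search that examines at most `n` options (a supremum over
a non-empty set that is bounded above). -/
noncomputable def Instance.optimalValue {m : ℕ} (I : Instance m) (n : ℕ) : ℝ :=
  sSup (I.searchValue '' {s | s.WithinBudget n})

theorem Instance.isLUB_optimalValue {m : ℕ} (I : Instance m) (n : ℕ) :
    IsLUB (I.searchValue '' {s | s.WithinBudget n}) (I.optimalValue n) := by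
  refine isLUB_csSup ⟨_, .halt none, fun b => by simp [Strategy.explored], rfl⟩
    ⟨∑ b : Realization m, (∏ i, if b i then I.p i else 1 - I.p i) * ∑ i, |I.x i|, ?_⟩
  rintro _ ⟨s, -, rfl⟩
  refine Finset.sum_le_sum fun b _ => mul_le_mul_of_nonneg_left ?_ (Finset.prod_nonneg fun i _ => ?_)
  · have hc : 0 ≤ ∑ i ∈ s.explored b, I.c i := Finset.sum_nonneg fun i _ => I.c_nonneg i
    have hx : 0 ≤ ∑ i, |I.x i| := Finset.sum_nonneg fun i _ => abs_nonneg _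
    have hi : ∀ i, I.x i ≤ ∑ i, |I.x i| := fun i => (le_abs_self _).trans
      (Finset.single_le_sum (f := fun i => |I.x i|) (fun i _ => abs_nonneg _) (Finset.mem_univ i))
    dsimp only [Instance.principalUtility]
    generalize s.result b = o
    rcases o with _ | i
    · simp only
      linarith
    · have := hi i
      simp only
      split_ifs <;> linarith
  · have := I.p_pos i
    have := I.p_le_one i
    split_ifs <;> linarith

/-! ### Delegation mechanisms -/

/-- A mechanism: a set of signals for the agent and an allocation function, which selects an
option, or the null outcome, given the agent's signal. -/
structure Mechanism (m : ℕ) where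
  Signal : Type
  alloc : Signal → Option (Fin m)

/-- The single-proposal mechanism with eligible set `R`: the agent proposes an option (or none),
and the proposal is accepted if and only if it belongs to `R`. -/
def singleProposal {m : ℕ} (R : Finset (Fin m)) : Mechanism m where
  Signal := Option (Fin m)
  alloc := fun o => o.filter fun i => decide (i ∈ R)

/-- The principal's expected net value when the agent plays `s`. -/
noncomputable def Instance.principalValue {m : ℕ} (I : Instance m) (M : Mechanism m)
    (s : Strategy m M.Signal) : ℝ :=
  I.expect fun b => I.principalUtility b (s.explored b) (M.alloc (s.result b))

/-- The agent's expected net value when he plays `s`. -/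
noncomputable def Instance.agentValue {m : ℕ} (I : Instance m) (M : Mechanism m)
    (s : Strategy m M.Signal) : ℝ :=
  I.expect fun b => I.agentUtility b (s.explored b) (M.alloc (s.result b))

/-- `s` is a best response of the agent, among all strategies that examine at most `n` options. -/
def Instance.IsBestResponse {m : ℕ} (I : Instance m) (n : ℕ) (M : Mechanism m)
    (s : Strategy m M.Signal) : Prop :=
  s.WithinBudget n ∧
    ∀ t : Strategy m M.Signal, t.WithinBudget n → I.agentValue M t ≤ I.agentValue M s

/-- The agent's priority of an option. -/
noncomputable def Instance.agentPriority {m : ℕ} (I : Instance m) (i : Fin m) : ℝ :=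
  I.y i - I.c i / I.p i

/-- Examine the options of the list in order, and propose the first one that is feasible. -/
def inOrder {m : ℕ} : List (Fin m) → Strategy m (Option (Fin m))
  | [] => .halt none
  | i :: l => .explore i (inOrder l) (.halt (some i))

/-- The list enumerates the set `R` without repetition, by non-increasing priority for the agent
(ties being broken arbitrarily). -/
def Instance.IsPriorityOrder {m : ℕ} (I : Instance m) (R : Finset (Fin m))
    (l : List (Fin m)) : Prop :=
  l.Nodup ∧ l.toFinset = R ∧ l.Pairwise fun i j => I.agentPriority j ≤ I.agentPriority i

theorem Instance.exists_isPriorityOrder {m : ℕ} (I : Instance m) (R : Finset (Fin m)) :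
    ∃ l : List (Fin m), I.IsPriorityOrder R l := by
  let r : Fin m → Fin m → Prop := fun i j => I.agentPriority j ≤ I.agentPriority i
  have : Std.Total r := ⟨fun i j => le_total _ _⟩
  have : IsTrans (Fin m) r := ⟨fun i j k h h' => le_trans h' h⟩
  classical
  have hp := List.perm_insertionSort r R.toList
  refine ⟨R.toList.insertionSort r, hp.nodup_iff.mpr R.nodup_toList, ?_,
    List.pairwise_insertionSort r _⟩
  ext i
  simp [hp.mem_iff]

/-- When at most `n` options may be examined, the single-proposal mechanism with eligible set `R`
attains the fraction `ρ` of the expected net value of the optimal search. That is: going through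
`R` by non-increasing priority and proposing the first feasible option is a best response of the
agent, whichever way ties are broken, and with this response the principal's expected net value is
at least `ρ` times that of the optimal search that examines at most `n` options. -/
def Instance.Attains {m : ℕ} (I : Instance m) (n : ℕ) (R : Finset (Fin m)) (ρ : ℝ) : Prop :=
  ∀ l : List (Fin m), I.IsPriorityOrder R l →
    I.IsBestResponse n (singleProposal R) (inOrder l) ∧
    ρ * I.optimalValue n ≤ I.principalValue (singleProposal R) (inOrder l)

/-! ### Programs and their running time

A random access machine with rational registers and arrays, presented as a structured programming
language, with the logarithmic cost measure: every operation costs the bit length of the numbers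
that it handles. Up to a polynomial this is the running time of a Turing machine. -/

/-- The bit length of a rational number (a sign, a numerator, a denominator). -/
def bits (q : ℚ) : ℕ := 1 + q.num.natAbs.size + q.den.size

/-- The memory: registers, and arrays `arr a 0, arr a 1, …`. -/
structure Memory where
  reg : ℕ → ℚ
  arr : ℕ → ℕ → ℚ

/-- Arithmetic expressions. -/
inductive Arith : Type where
  | const (q : ℚ) : Arith
  | reg (k : ℕ) : Arith
  | arr (a : ℕ) (index : Arith) : Arith
  | add (e f : Arith) : Arith
  | sub (e f : Arith) : Arith
  | mul (e f : Arith) : Arith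
  | div (e f : Arith) : Arith

/-- The value of an expression; an array index is rounded down to a natural number. -/
def Arith.val (M : Memory) : Arith → ℚ
  | .const q => q
  | .reg k => M.reg k
  | .arr a e => M.arr a ⌊e.val M⌋₊
  | .add e f => e.val M + f.val M
  | .sub e f => e.val M - f.val M
  | .mul e f => e.val M * f.val M
  | .div e f => e.val M / f.val M

/-- The cost of evaluating an expression: the total bit length of the values of all its
subexpressions (so every operation is charged for its operands and for its result). -/
def Arith.cost (M : Memory) : Arith → ℕ
  | .const q => bits q
  | .reg k => bits (M.reg k)
  | .arr a e => e.cost M + bits ((Arith.arr a e).val M)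
  | .add e f => e.cost M + f.cost M + bits ((Arith.add e f).val M)
  | .sub e f => e.cost M + f.cost M + bits ((Arith.sub e f).val M)
  | .mul e f => e.cost M + f.cost M + bits ((Arith.mul e f).val M)
  | .div e f => e.cost M + f.cost M + bits ((Arith.div e f).val M)

/-- Programs. Tests are comparisons `e ≤ f`. -/
inductive Program : Type where
  | skip : Program
  | setReg (k : ℕ) (e : Arith) : Program
  | setArr (a : ℕ) (index e : Arith) : Program
  | seq (P Q : Program) : Program
  | ifLe (e f : Arith) (P Q : Program) : Program
  | whileLe (e f : Arith) (P : Program) : Program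

/-- `Runs P M M' t`: started in the memory `M`, the program `P` halts in the memory `M'`, at the
total cost `t`. -/
inductive Runs : Program → Memory → Memory → ℕ → Prop
  | skip (M : Memory) : Runs .skip M M 1
  | setReg (k : ℕ) (e : Arith) (M : Memory) :
      Runs (.setReg k e) M { M with reg := Function.update M.reg k (e.val M) } (1 + e.cost M)
  | setArr (a : ℕ) (i e : Arith) (M : Memory) :
      Runs (.setArr a i e) M
        { M with arr := Function.update M.arr a
                          (Function.update (M.arr a) ⌊i.val M⌋₊ (e.val M)) }
        (1 + i.cost M + e.cost M)
  | seq {P Q : Program} {M M' M'' : Memory} {t t' : ℕ} :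
      Runs P M M' t → Runs Q M' M'' t' → Runs (.seq P Q) M M'' (t + t')
  | ifTrue {e f : Arith} {P Q : Program} {M M' : Memory} {t : ℕ} :
      e.val M ≤ f.val M → Runs P M M' t →
      Runs (.ifLe e f P Q) M M' (1 + e.cost M + f.cost M + t)
  | ifFalse {e f : Arith} {P Q : Program} {M M' : Memory} {t : ℕ} :
      ¬ e.val M ≤ f.val M → Runs Q M M' t →
      Runs (.ifLe e f P Q) M M' (1 + e.cost M + f.cost M + t)
  | whileDone {e f : Arith} {P : Program} {M : Memory} :
      ¬ e.val M ≤ f.val M → Runs (.whileLe e f P) M M (1 + e.cost M + f.cost M)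
  | whileStep {e f : Arith} {P : Program} {M M' M'' : Memory} {t t' : ℕ} :
      e.val M ≤ f.val M → Runs P M M' t → Runs (.whileLe e f P) M' M'' t' →
      Runs (.whileLe e f P) M M'' (1 + e.cost M + f.cost M + t + t')

/-- The numbers of an instance, as input to a program. -/
structure RationalData (m : ℕ) where
  p : Fin m → ℚ
  c : Fin m → ℚ
  x : Fin m → ℚ
  y : Fin m → ℚ

/-- The rational data are the numbers of the instance `I`. -/
def RationalData.Describes {m : ℕ} (d : RationalData m) (I : Instance m) : Prop :=
  ∀ i, I.p i = d.p i ∧ I.c i = d.c i ∧ I.x i = d.x i ∧ I.y i = d.y i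

/-- The length in bits of the input that consists of the instance, the budget `n`, and `ε`. -/
def inputSize {m : ℕ} (d : RationalData m) (n : ℕ) (ε : ℚ) : ℕ :=
  bits m + bits n + bits ε +
    ∑ i, (bits (d.p i) + bits (d.c i) + bits (d.x i) + bits (d.y i))

/-- The initial memory: registers `0, 1, 2` hold `m, n, ε`, arrays `0, 1, 2, 3` hold the
probabilities, the costs, and the two lists of values; everything else is `0`. -/
def inputMemory {m : ℕ} (d : RationalData m) (n : ℕ) (ε : ℚ) : Memory where
  reg := fun k => if k = 0 then m else if k = 1 then n else if k = 2 then ε else 0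
  arr := fun a i =>
    if h : i < m then
      if a = 0 then d.p ⟨i, h⟩ else if a = 1 then d.c ⟨i, h⟩
      else if a = 2 then d.x ⟨i, h⟩ else if a = 3 then d.y ⟨i, h⟩ else 0
    else 0

/-- The final memory contains the list `l`: its length in register `0`, its entries in array `0`. -/
def Memory.Outputs {m : ℕ} (M : Memory) (l : List (Fin m)) : Prop :=
  M.reg 0 = l.length ∧ ∀ (k : ℕ) (h : k < l.length), M.arr 0 k = ((l[k] : Fin m) : ℕ)

end DelegatedSearch

namespace DelegatedSearch

open Finset

variable {m : ℕ}

/-! ### Expectations -/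

/-! Charge the cost of an examined option only if it is feasible, at the rate `c i / p i`. Whether
an option is examined is independent of its feasibility, so expected utilities do not change
(`Instance.expect_cost`). The costs are thereby absorbed into the values: z_i = x_i - c_i/p_i for
the principal, w_i = y_i - c_i/p_i for the agent.

For τ ≥ 0 let g(τ) be the largest sum, over at most n options, of the positive parts of p_i(x_i - τ)
- c_i = p_i(z_i - τ). A claim is worth at most τ plus its excess over τ, hence OPT ≤ τ + g(τ)
(`Instance.optimalValue_le`). Conversely, let R attain g(τ) with non-negative terms. In whatever
order R is examined, the principal gets at least (1 - Q)τ + Q g(τ), where Q is the probability that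
no option of R is feasible (`Instance.le_expectFirst`), so at least min(τ, g(τ)). The order by w_i
gives the agent the largest w_i among the feasible options of R in every realization, which no
strategy beats in expectation (`Instance.isBestResponse_inOrder`).

The guaranteed fraction is therefore min(τ, g(τ)) / (τ + g(τ)). The balanced threshold τ = g(τ)
exists and yields 1/2 (`Instance.exists_attains_half`), more than part (1) needs. For part (2) the
rough balance g(τ) ≤ τ ≤ 2g(τ) yields 1/3, and 1/3 ≥ (1/2)(1 - 1/e) because e < 3. So the program
can ignore ε: it raises τ from 0 in steps of g(0)/(2(m+1)²) until τ ≥ g(τ). As g is non-increasing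
and m-Lipschitz, the overshoot is harmless (`threshold_le_two_mul`).

The program is verified with triples `Exec` that count steps and keep a common bound on the width of
all stored numbers; the running time is the number of steps times a uniform cost per step. -/

theorem Instance.expect_eq_add (I : Instance m) (j : Fin m) (f : Realization m → ℝ) :
    I.expect f = I.p j * I.expect (fun b => f (Function.update b j true)) +
      (1 - I.p j) * I.expect (fun b => f (Function.update b j false)) := by
  let e := Equiv.funSplitAt j Bool
  let A : (({i : Fin m // i ≠ j} → Bool) → ℝ) → ℝ := fun g =>
    ∑ b, (∏ i, if b i then I.p i else 1 - I.p i) * g b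
  have key : ∀ f : Realization m → ℝ, I.expect f =
      I.p j * A (fun b => f (e.symm (true, b))) +
        (1 - I.p j) * A (fun b => f (e.symm (false, b))) := by
    intro f
    unfold Instance.expect
    rw [← e.symm.sum_comp, Fintype.sum_prod_type]
    simp only [Fintype.sum_bool, A, Finset.mul_sum]
    congr 1 <;>
    · refine Finset.sum_congr rfl fun b _ => ?_
      rw [Fintype.prod_eq_mul_prod_subtype_ne _ j, ← mul_assoc]
      congr 2
      · simp [e, Equiv.funSplitAt, Equiv.piSplitAt]
      · refine Finset.prod_congr rfl fun i _ => ?_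
        simp [e, Equiv.funSplitAt, Equiv.piSplitAt, i.2]
  -- Overwriting coordinate j affects only the first component of the split, so both conditional
  -- expectations are sums over the other coordinates.
  have hu : ∀ (v v' : Bool) b, Function.update (e.symm (v, b)) j v' = e.symm (v', b) := by
    intro v v' b
    ext i
    by_cases h : i = j
    · subst h; simp [e, Equiv.funSplitAt, Equiv.piSplitAt]
    · simp [e, Equiv.funSplitAt, Equiv.piSplitAt, h]
  rw [key f, key (fun b => f (Function.update b j true)),
    key (fun b => f (Function.update b j false))]
  simp only [hu]
  ring

theorem Instance.weight_nonneg (I : Instance m) (b : Realization m) :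
    0 ≤ ∏ i, if b i then I.p i else 1 - I.p i := by
  refine Finset.prod_nonneg fun i _ => ?_
  have := I.p_pos i
  have := I.p_le_one i
  split_ifs <;> linarith

theorem Instance.expect_mono (I : Instance m) {f g : Realization m → ℝ} (h : ∀ b, f b ≤ g b) :
    I.expect f ≤ I.expect g :=
  Finset.sum_le_sum fun b _ => mul_le_mul_of_nonneg_left (h b) (I.weight_nonneg b)

theorem Instance.expect_add (I : Instance m) (f g : Realization m → ℝ) :
    I.expect (fun b => f b + g b) = I.expect f + I.expect g := by
  simp [Instance.expect, mul_add, Finset.sum_add_distrib]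

theorem Instance.expect_sub (I : Instance m) (f g : Realization m → ℝ) :
    I.expect (fun b => f b - g b) = I.expect f - I.expect g := by
  simp [Instance.expect, mul_sub, Finset.sum_sub_distrib]

theorem Instance.expect_const_mul (I : Instance m) (a : ℝ) (f : Realization m → ℝ) :
    I.expect (fun b => a * f b) = a * I.expect f := by
  simp only [Instance.expect, Finset.mul_sum]
  exact Finset.sum_congr rfl fun b _ => by ring

theorem Instance.expect_sum (I : Instance m) {ι : Type*} (s : Finset ι)
    (f : ι → Realization m → ℝ) :
    I.expect (fun b => ∑ i ∈ s, f i b) = ∑ i ∈ s, I.expect (f i) := by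
  simp only [Instance.expect, Finset.mul_sum]
  exact Finset.sum_comm

theorem Instance.expect_const (I : Instance m) (a : ℝ) : I.expect (fun _ => a) = a := by
  unfold Instance.expect
  rw [← Finset.sum_mul]
  have := Finset.prod_univ_sum (fun _ : Fin m => (Finset.univ : Finset Bool))
    (fun i v => if v then I.p i else 1 - I.p i)
  rw [Fintype.piFinset_univ] at this
  rw [← this]
  simp

theorem Instance.expect_ite (I : Instance m) (i : Fin m) {f : Realization m → ℝ}
    (h : ∀ b v, f (Function.update b i v) = f b) :
    I.expect (fun b => if b i then f b else 0) = I.p i * I.expect f := by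
  rw [I.expect_eq_add i]
  have h1 : (fun b => if Function.update b i true i then f (Function.update b i true) else 0) =
      f := by
    ext b
    rw [Function.update_self, if_pos rfl, h]
  have h2 : (fun b => if Function.update b i false i then f (Function.update b i false) else 0) =
      fun _ => 0 := by
    ext b
    rw [Function.update_self, if_neg Bool.false_ne_true]
  rw [h1, h2, I.expect_const]
  ring

theorem Strategy.mem_explored_update {α : Type} (s : Strategy m α) (b : Realization m)
    (j : Fin m) (v : Bool) : j ∈ s.explored (Function.update b j v) ↔ j ∈ s.explored b := by
  induction s with
  | halt a => simp [Strategy.explored]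
  | explore i s t hs ht =>
    by_cases h : j = i
    · simp [Strategy.explored, h]
    · have : i ≠ j := fun h' => h h'.symm
      cases hb : b i <;> simp [Strategy.explored, this, hb, hs, ht]

/-- Whether an option is examined is independent of whether it is feasible. -/
theorem Instance.expect_sum_explored {α : Type} (I : Instance m) (s : Strategy m α)
    (a : Fin m → ℝ) :
    I.expect (fun b => ∑ i ∈ s.explored b, if b i then a i else 0) =
      I.expect (fun b => ∑ i ∈ s.explored b, I.p i * a i) := by
  have h : ∀ (b : Realization m) (f : Fin m → ℝ),
      ∑ i ∈ s.explored b, f i = ∑ i, if i ∈ s.explored b then f i else 0 := fun b f => by simp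
  simp only [h]
  rw [I.expect_sum, I.expect_sum]
  refine Finset.sum_congr rfl fun i _ => ?_
  have h1 : (fun b => if i ∈ s.explored b then if b i then a i else 0 else 0) =
      fun b : Realization m => if b i then (if i ∈ s.explored b then a i else 0) else 0 := by
    ext b
    split_ifs <;> rfl
  rw [h1, I.expect_ite i (fun b v => by simp only [s.mem_explored_update]),
    ← I.expect_const_mul]
  congr 1
  ext b
  split_ifs <;> simp

/-- This is the amortization on which both the upper bound and the incentive argument rest: a cost
paid on examination is traded for one paid only on success. -/
theorem Instance.expect_cost {α : Type} (I : Instance m) (s : Strategy m α) :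
    I.expect (fun b => ∑ i ∈ s.explored b, I.c i) =
      I.expect (fun b => ∑ i ∈ s.explored b, if b i then I.c i / I.p i else 0) := by
  rw [I.expect_sum_explored]
  simp only [fun i => mul_div_cancel₀ (I.c i) (I.p_pos i).ne']

/-! ### The optimal search -/

theorem Instance.searchValue_le (I : Instance m) {n : ℕ} {τ g : ℝ} (hτ : 0 ≤ τ)
    (hg : ∀ S : Finset (Fin m), S.card ≤ n →
      ∑ i ∈ S, max (I.p i * (I.x i - τ) - I.c i) 0 ≤ g)
    {s : Strategy m (Option (Fin m))} (hs : s.WithinBudget n) : I.searchValue s ≤ τ + g := by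
  -- Pointwise bound after amortization: the claimed option yields its z-value, which is at most τ
  -- plus its excess over τ; all other deferred costs and excesses have a favourable sign.
  have key : ∀ b : Realization m,
      I.principalUtility b (s.explored b) (s.result b) + ∑ i ∈ s.explored b, I.c i -
        ∑ i ∈ s.explored b, (if b i then I.c i / I.p i else 0) ≤
      τ + ∑ i ∈ s.explored b, if b i then max (I.x i - I.c i / I.p i - τ) 0 else 0 := by
    intro b
    generalize s.explored b = E
    generalize s.result b = o
    have h0 : ∀ i, 0 ≤ if b i then max (I.x i - I.c i / I.p i - τ) 0 else 0 := fun i => by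
      split_ifs
      · exact le_max_right _ _
      · exact le_rfl
    have h1 : ∀ i, 0 ≤ if b i then I.c i / I.p i else 0 := fun i => by
      have := div_nonneg (I.c_nonneg i) (I.p_pos i).le
      split_ifs
      · exact this
      · exact le_rfl
    have h2 := Finset.sum_nonneg fun i (_ : i ∈ E) => h0 i
    have h3 := Finset.sum_nonneg fun i (_ : i ∈ E) => h1 i
    rcases o with _ | i
    · simp only [Instance.principalUtility]
      linarith
    · simp only [Instance.principalUtility]
      by_cases hi : i ∈ E ∧ b i = true
      · have h4 := Finset.single_le_sum (fun i (_ : i ∈ E) => h0 i) hi.1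
        have h5 := Finset.single_le_sum (fun i (_ : i ∈ E) => h1 i) hi.1
        simp only [hi.2, if_true] at h4 h5
        rw [if_pos hi]
        have := le_max_left (I.x i - I.c i / I.p i - τ) 0
        linarith
      · rw [if_neg hi]
        linarith
  have h := I.expect_mono key
  rw [I.expect_sub, I.expect_add, I.expect_add, I.expect_cost, I.expect_const,
    add_sub_cancel_right,
    I.expect_sum_explored s fun i => max (I.x i - I.c i / I.p i - τ) 0] at h
  refine h.trans (add_le_add le_rfl ?_)
  rw [← I.expect_const g]
  refine I.expect_mono fun b => le_trans (le_of_eq ?_) (hg _ (hs b))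
  refine Finset.sum_congr rfl fun i _ => ?_
  have hp := I.p_pos i
  rw [mul_max_of_nonneg _ _ hp.le]
  congr 1
  · field_simp
    ring
  · simp

theorem Instance.optimalValue_le (I : Instance m) {n : ℕ} {τ g : ℝ} (hτ : 0 ≤ τ)
    (hg : ∀ S : Finset (Fin m), S.card ≤ n →
      ∑ i ∈ S, max (I.p i * (I.x i - τ) - I.c i) 0 ≤ g) : I.optimalValue n ≤ τ + g := by
  refine (I.isLUB_optimalValue n).2 ?_
  rintro _ ⟨s, hs, rfl⟩
  exact I.searchValue_le hτ hg hs

theorem Instance.optimalValue_nonneg (I : Instance m) (n : ℕ) : 0 ≤ I.optimalValue n := by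
  refine (I.isLUB_optimalValue n).1 ⟨.halt none, fun b => by simp [Strategy.explored], ?_⟩
  simp [Instance.searchValue, Instance.principalUtility, Strategy.explored, Strategy.result,
    I.expect_const]

/-! ### Examining options in a fixed order -/

theorem result_inOrder (l : List (Fin m)) (b : Realization m) :
    (inOrder l).result b = l.find? b := by
  induction l with
  | nil => rfl
  | cons i l ih => cases hb : b i <;> simp [inOrder, Strategy.result, hb, ih]

theorem explored_inOrder_subset (l : List (Fin m)) (b : Realization m) :
    (inOrder l).explored b ⊆ l.toFinset := by
  induction l with
  | nil => simp [inOrder, Strategy.explored]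
  | cons i l ih =>
    cases hb : b i
    · simpa [inOrder, Strategy.explored, hb] using Finset.insert_subset_insert i ih
    · simp [inOrder, Strategy.explored, hb]

theorem mem_explored_inOrder {l : List (Fin m)} {b : Realization m} {i : Fin m}
    (h : l.find? b = some i) : i ∈ (inOrder l).explored b := by
  induction l with
  | nil => simp at h
  | cons j l ih =>
    cases hb : b j
    · simp only [List.find?_cons, hb] at h
      simp [inOrder, Strategy.explored, hb, ih h]
    · simp only [List.find?_cons, hb, Option.some.injEq] at h
      simp [inOrder, Strategy.explored, h]

/-- The search stops at the first success, so at most one examined option is feasible. -/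
theorem sum_explored_inOrder (l : List (Fin m)) (b : Realization m) (a : Fin m → ℝ) :
    ∑ i ∈ (inOrder l).explored b, (if b i then a i else 0) = (l.find? b).elim 0 a := by
  induction l with
  | nil => simp [inOrder, Strategy.explored]
  | cons j l ih =>
    cases hb : b j
    · simp only [inOrder, Strategy.explored, hb, List.find?_cons]
      rw [Finset.sum_insert_zero (by simp [hb])]
      simpa using ih
    · simp [inOrder, Strategy.explored, hb]

/-- The expected value of the first feasible option of a list. -/
noncomputable def Instance.expectFirst (I : Instance m) (v : Fin m → ℝ) (l : List (Fin m)) : ℝ :=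
  I.expect fun b => (l.find? b).elim 0 v

theorem Instance.expectFirst_nil (I : Instance m) (v : Fin m → ℝ) : I.expectFirst v [] = 0 := by
  simp [Instance.expectFirst, I.expect_const]

theorem find?_update {l : List (Fin m)} {i : Fin m} (hi : i ∉ l) (b : Realization m) (v : Bool) :
    l.find? (Function.update b i v) = l.find? b := by
  induction l with
  | nil => rfl
  | cons j l ih =>
    simp only [List.mem_cons, not_or] at hi
    simp only [List.find?_cons, ih hi.2, Function.update_of_ne (Ne.symm hi.1)]

theorem Instance.expectFirst_cons (I : Instance m) (v : Fin m → ℝ) {i : Fin m}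
    {l : List (Fin m)} (hi : i ∉ l) :
    I.expectFirst v (i :: l) = I.p i * v i + (1 - I.p i) * I.expectFirst v l := by
  unfold Instance.expectFirst
  rw [I.expect_eq_add i]
  simp [find?_update hi, I.expect_const]

theorem alloc_singleProposal_find? {R : Finset (Fin m)} {l : List (Fin m)} (hl : l.toFinset = R)
    (b : Realization m) : (singleProposal R).alloc (l.find? b) = l.find? b := by
  cases h : l.find? b with
  | none => rfl
  | some i =>
    have : i ∈ R := hl ▸ List.mem_toFinset.mpr (List.mem_of_find?_eq_some h)
    simp [singleProposal, this, Option.filter]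

/-- With deferred costs only the proposed option is charged, so the net value is that of the first
feasible option at its z-value. -/
theorem Instance.principalValue_inOrder (I : Instance m) {R : Finset (Fin m)}
    {l : List (Fin m)} (hl : l.toFinset = R) :
    I.principalValue (singleProposal R) (inOrder l) =
      I.expectFirst (fun i => I.x i - I.c i / I.p i) l := by
  have key : ∀ b : Realization m, I.principalUtility b ((inOrder l).explored b)
      ((singleProposal R).alloc ((inOrder l).result b)) = (l.find? b).elim 0 I.x -
        ∑ i ∈ (inOrder l).explored b, I.c i := by
    intro b
    rw [result_inOrder, alloc_singleProposal_find? hl]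
    cases h : l.find? b with
    | none => simp [Instance.principalUtility]
    | some i =>
      have h1 := mem_explored_inOrder h
      have h2 : b i = true := List.find?_some h
      simp [Instance.principalUtility, h1, h2]
  refine (congrArg I.expect (funext key)).trans ?_
  unfold Instance.expectFirst
  rw [I.expect_sub, I.expect_cost]
  simp only [sum_explored_inOrder]
  rw [← I.expect_sub]
  congr 1
  ext b
  cases l.find? b <;> simp

theorem Instance.agentValue_inOrder (I : Instance m) {R : Finset (Fin m)}
    {l : List (Fin m)} (hl : l.toFinset = R) :
    I.agentValue (singleProposal R) (inOrder l) = I.expectFirst I.agentPriority l := by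
  have key : ∀ b : Realization m, I.agentUtility b ((inOrder l).explored b)
      ((singleProposal R).alloc ((inOrder l).result b)) = (l.find? b).elim 0 I.y -
        ∑ i ∈ (inOrder l).explored b, I.c i := by
    intro b
    rw [result_inOrder, alloc_singleProposal_find? hl]
    cases h : l.find? b with
    | none => simp [Instance.agentUtility]
    | some i =>
      have h1 := mem_explored_inOrder h
      have h2 : b i = true := List.find?_some h
      simp [Instance.agentUtility, h1, h2]
  refine (congrArg I.expect (funext key)).trans ?_
  unfold Instance.expectFirst
  rw [I.expect_sub, I.expect_cost]
  simp only [sum_explored_inOrder]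
  rw [← I.expect_sub]
  congr 1
  ext b
  cases l.find? b <;> simp [Instance.agentPriority]

/-! ### Best responses of the agent -/

theorem Instance.agentPriority_nonneg (I : Instance m) (i : Fin m) : 0 ≤ I.agentPriority i := by
  rw [Instance.agentPriority, sub_nonneg, div_le_iff₀ (I.p_pos i), mul_comm]
  exact I.c_le i

theorem mem_of_alloc_singleProposal {R : Finset (Fin m)} {o : Option (Fin m)} {i : Fin m}
    (h : (singleProposal R).alloc o = some i) : i ∈ R := by
  have h : Option.filter (fun i => decide (i ∈ R)) o = some i := h
  rw [Option.filter_eq_some_iff] at h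
  simpa using h.2

theorem le_elim_find? {l : List (Fin m)} {v : Fin m → ℝ}
    (hl : l.Pairwise fun i j => v j ≤ v i) {b : Realization m} {i : Fin m} (hi : i ∈ l)
    (hb : b i = true) : v i ≤ (l.find? b).elim 0 v := by
  induction l with
  | nil => simp at hi
  | cons j l ih =>
    rw [List.pairwise_cons] at hl
    cases h : b j
    · have : i ≠ j := by rintro rfl; simp [hb] at h
      simpa [List.find?_cons, h] using ih hl.2 ((List.mem_cons.mp hi).resolve_left this)
    · simp only [List.find?_cons, h, Option.elim_some]
      rcases List.mem_cons.mp hi with rfl | hi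
      · exact le_rfl
      · exact hl.1 i hi

theorem Instance.isBestResponse_inOrder (I : Instance m) {n : ℕ} {R : Finset (Fin m)}
    (hR : R.card ≤ n) {l : List (Fin m)} (hl : I.IsPriorityOrder R l) :
    I.IsBestResponse n (singleProposal R) (inOrder l) := by
  obtain ⟨-, hlR, hl⟩ := hl
  refine ⟨fun b => ?_, fun t _ => ?_⟩
  · exact (Finset.card_le_card (explored_inOrder_subset l b)).trans (hlR ▸ hR)
  rw [I.agentValue_inOrder hlR]
  -- Pointwise in the realization: an accepted, examined and feasible proposal nets at most its
  -- priority, and the list finds the largest priority among feasible options of R. Every other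
  -- outcome nets at most 0, and priorities are non-negative.
  have key : ∀ b : Realization m, I.agentUtility b (t.explored b)
      ((singleProposal R).alloc (t.result b)) + ∑ i ∈ t.explored b, I.c i -
        ∑ i ∈ t.explored b, (if b i then I.c i / I.p i else 0) ≤
      (l.find? b).elim 0 I.agentPriority := by
    intro b
    have hoR : ∀ i, (singleProposal R).alloc (t.result b) = some i → i ∈ R :=
      fun i h => mem_of_alloc_singleProposal h
    revert hoR
    generalize t.explored b = E
    generalize (singleProposal R).alloc (t.result b) = o
    intro hoR
    have h1 : ∀ i, 0 ≤ if b i then I.c i / I.p i else 0 := fun i => by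
      have := div_nonneg (I.c_nonneg i) (I.p_pos i).le
      split_ifs
      · exact this
      · exact le_rfl
    have h3 := Finset.sum_nonneg fun i (_ : i ∈ E) => h1 i
    have h4 : 0 ≤ (l.find? b).elim 0 I.agentPriority := by
      cases l.find? b with
      | none => simp
      | some i => simpa using I.agentPriority_nonneg i
    rcases o with _ | i
    · simp only [Instance.agentUtility]
      linarith
    · have hi : i ∈ l := by
        have := hoR i rfl
        rw [← hlR] at this
        simpa using this
      simp only [Instance.agentUtility]
      by_cases hE : i ∈ E
      · rw [if_pos hE]
        by_cases hb : b i = true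
        · have h5 := Finset.single_le_sum (fun i (_ : i ∈ E) => h1 i) hE
          have h6 := le_elim_find? hl hi hb
          rw [if_pos hb] at h5
          rw [if_pos hb]
          rw [Instance.agentPriority] at h6
          linarith
        · rw [if_neg hb]
          linarith
      · rw [if_neg hE]
        linarith
  have h := I.expect_mono key
  rw [I.expect_sub, I.expect_add, I.expect_cost, add_sub_cancel_right] at h
  exact h

/-! ### Prophet inequality and choice of the threshold -/

/-- A prophet inequality for an arbitrary order, with threshold `τ`. -/
theorem Instance.le_expectFirst (I : Instance m) (v : Fin m → ℝ) (τ : ℝ) {l : List (Fin m)}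
    (hl : l.Nodup) (hv : ∀ i ∈ l, τ ≤ v i) :
    ∃ Q : ℝ, 0 ≤ Q ∧ Q ≤ 1 ∧
      τ * (1 - Q) + Q * (l.map fun i => I.p i * (v i - τ)).sum ≤ I.expectFirst v l := by
  induction l with
  -- Q is the probability that no option of the list is feasible, hence 1 here and the factor 1 -
  -- p_i in the induction step.
  | nil => exact ⟨1, by norm_num, le_rfl, by simp [I.expectFirst_nil]⟩
  | cons i l ih =>
    rw [List.nodup_cons] at hl
    obtain ⟨Q, h0, h1, h⟩ := ih hl.2 fun j hj => hv j (List.mem_cons_of_mem _ hj)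
    have hp := (I.p_pos i).le
    have hp' := sub_nonneg.mpr (I.p_le_one i)
    have hvi := sub_nonneg.mpr (hv i List.mem_cons_self)
    refine ⟨(1 - I.p i) * Q, mul_nonneg hp' h0, ?_, ?_⟩
    · nlinarith
    · rw [I.expectFirst_cons v hl.1, List.map_cons, List.sum_cons]
      have h2 := mul_le_mul_of_nonneg_left h hp'
      -- This is exactly the slack left over in the induction step.
      have h3 : 0 ≤ I.p i * (v i - τ) * (1 - (1 - I.p i) * Q) :=
        mul_nonneg (mul_nonneg hp hvi) (by nlinarith)
      nlinarith

/-- The principal's value is at least a convex combination of τ and the sum over R; `h1` and `h2`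
bound each of them below by a ρ-fraction of the upper bound τ + g on the optimum. -/
theorem Instance.attains_of_threshold (I : Instance m) {n : ℕ} {R : Finset (Fin m)}
    {τ g ρ ρ' : ℝ} (hR : R.card ≤ n) (hτ : 0 ≤ τ)
    (hg : ∀ S : Finset (Fin m), S.card ≤ n →
      ∑ i ∈ S, max (I.p i * (I.x i - τ) - I.c i) 0 ≤ g)
    (hRτ : ∀ i ∈ R, 0 ≤ I.p i * (I.x i - τ) - I.c i) (hρ : 0 ≤ ρ) (hρ' : ρ' ≤ ρ)
    (h1 : ρ * (τ + g) ≤ τ) (h2 : ρ * (τ + g) ≤ ∑ i ∈ R, (I.p i * (I.x i - τ) - I.c i)) :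
    I.Attains n R ρ' := by
  intro l hl
  refine ⟨I.isBestResponse_inOrder hR hl, ?_⟩
  obtain ⟨hn, hlR, -⟩ := hl
  have hpz : ∀ i, I.p i * (I.x i - τ) - I.c i = I.p i * (I.x i - I.c i / I.p i - τ) := fun i => by
    have := (I.p_pos i).ne'
    field_simp
    ring
  rw [I.principalValue_inOrder hlR]
  obtain ⟨Q, h0, hQ1, h⟩ := I.le_expectFirst (fun i => I.x i - I.c i / I.p i) τ hn
    (fun i hi => by
      have := hRτ i (hlR ▸ List.mem_toFinset.mpr hi)
      rw [hpz] at this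
      exact sub_nonneg.mp (nonneg_of_mul_nonneg_right this (I.p_pos i)))
  have hs : (l.map fun i => I.p i * (I.x i - I.c i / I.p i - τ)).sum =
      ∑ i ∈ R, (I.p i * (I.x i - τ) - I.c i) := by
    rw [← hlR, List.sum_toFinset _ hn]
    simp only [hpz]
  rw [hs] at h
  refine le_trans ?_ h
  have hO := I.optimalValue_le hτ hg
  have hO' := I.optimalValue_nonneg n
  have h3 : ρ' * I.optimalValue n ≤ ρ * (τ + g) :=
    (mul_le_mul_of_nonneg_right hρ' hO').trans (mul_le_mul_of_nonneg_left hO hρ)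
  nlinarith [mul_le_mul_of_nonneg_left h1 (sub_nonneg.mpr hQ1), mul_le_mul_of_nonneg_left h2 h0]

theorem Instance.exists_attains_half (I : Instance m) (n : ℕ) {ρ : ℝ} (hρ : ρ ≤ 1 / 2) :
    ∃ R : Finset (Fin m), I.Attains n R ρ := by
  classical
  have hne : (univ.filter fun S : Finset (Fin m) => S.card ≤ n).Nonempty := ⟨∅, by simp⟩
  -- The sum of p_i(x_i - τ) - c_i over S is at most τ iff r(S) ≤ τ, with equality iff r(S) = τ. So
  -- the maximum of r over sets of size at most n solves τ = g(τ), without any continuity argument.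
  let r : Finset (Fin m) → ℝ := fun S =>
    (∑ i ∈ S, (I.p i * I.x i - I.c i)) / (1 + ∑ i ∈ S, I.p i)
  obtain ⟨T, hT, hmax⟩ := Finset.exists_max_image _ r hne
  simp only [mem_filter, mem_univ, true_and] at hT hmax
  have hpos : ∀ S : Finset (Fin m), 0 < 1 + ∑ i ∈ S, I.p i := fun S => by
    have := Finset.sum_nonneg fun i (_ : i ∈ S) => (I.p_pos i).le
    linarith
  have hsum : ∀ S : Finset (Fin m), ∑ i ∈ S, (I.p i * (I.x i - r T) - I.c i) =
      ∑ i ∈ S, (I.p i * I.x i - I.c i) - (∑ i ∈ S, I.p i) * r T := fun S => by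
    rw [Finset.sum_mul, ← Finset.sum_sub_distrib]
    exact Finset.sum_congr rfl fun i _ => by ring
  have hr : ∀ S : Finset (Fin m), ∑ i ∈ S, (I.p i * I.x i - I.c i) =
      r S * (1 + ∑ i ∈ S, I.p i) := fun S => (div_mul_cancel₀ _ (hpos S).ne').symm
  have hτ : 0 ≤ r T := by
    have := hmax ∅ (by simp)
    simpa [r] using this
  have hle : ∀ S : Finset (Fin m), S.card ≤ n →
      ∑ i ∈ S, (I.p i * (I.x i - r T) - I.c i) ≤ r T := fun S hS => by
    rw [hsum, hr]
    nlinarith [mul_le_mul_of_nonneg_right (hmax S hS) (hpos S).le]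
  have hTs : ∑ i ∈ T, (I.p i * (I.x i - r T) - I.c i) = r T := by
    rw [hsum, hr]
    ring
  -- Dropping negative terms only increases the sum over T, and makes every remaining option satisfy
  -- z_i ≥ τ.
  refine ⟨T.filter fun i => 0 ≤ I.p i * (I.x i - r T) - I.c i,
    I.attains_of_threshold (τ := r T) (g := r T) (ρ := 1 / 2)
      ((card_filter_le _ _).trans hT) hτ ?_ (fun i hi => (mem_filter.mp hi).2)
      (by norm_num) hρ (by linarith) ?_⟩
  · intro S hS
    refine le_trans (le_of_eq ?_) (hle (S.filter fun i => 0 ≤ I.p i * (I.x i - r T) - I.c i)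
      ((card_filter_le _ _).trans hS))
    rw [Finset.sum_filter]
    refine Finset.sum_congr rfl fun i _ => ?_
    split_ifs with h
    · exact max_eq_left h
    · exact max_eq_right (not_le.mp h).le
  · have : ∑ i ∈ T, (I.p i * (I.x i - r T) - I.c i) ≤
        ∑ i ∈ T.filter fun i => 0 ≤ I.p i * (I.x i - r T) - I.c i,
          (I.p i * (I.x i - r T) - I.c i) := by
      rw [Finset.sum_filter]
      refine Finset.sum_le_sum fun i _ => ?_
      split_ifs with h
      · exact le_rfl
      · exact (not_le.mp h).le
    linarith

/-! ### Ranks -/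

/-- `j` precedes `i` when the indices are sorted by decreasing key, ties being broken by index. -/
abbrev Precedes (K : ℕ → ℚ) (j i : ℕ) : Prop := K i < K j ∨ K i = K j ∧ j < i

/-- The number of elements of `A` that precede `i`. -/
def rank (K : ℕ → ℚ) (A : Finset ℕ) (i : ℕ) : ℕ := (A.filter fun j => Precedes K j i).card

theorem Precedes.trans {K : ℕ → ℚ} {i j k : ℕ} (h : Precedes K i j) (h' : Precedes K j k) :
    Precedes K i k := by
  rcases h with h | ⟨h, h1⟩ <;> rcases h' with h' | ⟨h', h2⟩
  · exact Or.inl (h'.trans h)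
  · exact Or.inl (h' ▸ h)
  · exact Or.inl (h ▸ h')
  · exact Or.inr ⟨h'.trans h, h1.trans h2⟩

theorem precedes_or_precedes (K : ℕ → ℚ) {i j : ℕ} (h : i ≠ j) :
    Precedes K i j ∨ Precedes K j i := by
  rcases lt_trichotomy (K i) (K j) with h1 | h1 | h1
  · exact Or.inr (Or.inl h1)
  · rcases lt_or_gt_of_ne h with h2 | h2
    · exact Or.inl (Or.inr ⟨h1.symm, h2⟩)
    · exact Or.inr (Or.inr ⟨h1, h2⟩)
  · exact Or.inl (Or.inl h1)

theorem rank_lt_rank {K : ℕ → ℚ} {A : Finset ℕ} {i j : ℕ} (hj : j ∈ A) (h : Precedes K j i) :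
    rank K A j < rank K A i := by
  refine card_lt_card (Finset.ssubset_iff_of_subset ?_ |>.mpr ⟨j, ?_, ?_⟩)
  · intro k hk
    rw [mem_filter] at hk ⊢
    exact ⟨hk.1, hk.2.trans h⟩
  · exact mem_filter.mpr ⟨hj, h⟩
  · simp

theorem key_le_of_rank_le {K : ℕ → ℚ} {A : Finset ℕ} {i j : ℕ} (hj : j ∈ A)
    (h : rank K A i ≤ rank K A j) : K j ≤ K i := by
  by_contra h'
  exact absurd (rank_lt_rank hj (Or.inl (not_le.mp h'))) (not_lt.mpr h)

theorem rank_lt_card {K : ℕ → ℚ} {A : Finset ℕ} {i : ℕ} (hi : i ∈ A) : rank K A i < A.card := by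
  refine card_lt_card (Finset.ssubset_iff_of_subset (filter_subset _ _) |>.mpr ⟨i, hi, ?_⟩)
  simp

theorem rank_injOn (K : ℕ → ℚ) (A : Finset ℕ) : Set.InjOn (rank K A) A := by
  intro i hi j hj h
  by_contra hne
  rcases precedes_or_precedes K hne with h' | h'
  · exact absurd h (rank_lt_rank hi h').ne
  · exact absurd h (rank_lt_rank hj h').ne'

theorem image_rank (K : ℕ → ℚ) (A : Finset ℕ) : A.image (rank K A) = range A.card := by
  refine eq_of_subset_of_card_le ?_ ?_
  · intro k hk
    obtain ⟨i, hi, rfl⟩ := mem_image.mp hk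
    exact mem_range.mpr (rank_lt_card hi)
  · rw [card_range, card_image_of_injOn (rank_injOn K A)]

/-- Ranks biject `A` with an initial segment of ℕ, because ties are broken by index. -/
theorem card_filter_rank_lt (K : ℕ → ℚ) (A : Finset ℕ) (n : ℕ) :
    (A.filter fun i => rank K A i < n).card = min n A.card := by
  rw [← card_image_of_injOn ((rank_injOn K A).mono (coe_subset.mpr (filter_subset _ A)))]
  have : (A.filter fun i => rank K A i < n).image (rank K A) = range (min n A.card) := by
    have h : (A.filter fun i => rank K A i < n).image (rank K A) =
        (A.image (rank K A)).filter (· < n) := by rw [filter_image]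
    rw [h, image_rank]
    ext k
    simp [and_comm]
  rw [this, card_range]

/-- The indices of the `n` largest keys, as far as these are positive. -/
def top (K : ℕ → ℚ) (A : Finset ℕ) (n : ℕ) : Finset ℕ :=
  A.filter fun i => rank K A i < n ∧ 0 < K i

theorem card_top_le (K : ℕ → ℚ) (A : Finset ℕ) (n : ℕ) : (top K A n).card ≤ n := by
  refine (card_le_card ?_).trans ((card_filter_rank_lt K A n).trans_le (min_le_left _ _))
  exact fun i hi => mem_filter.mpr ⟨(mem_filter.mp hi).1, (mem_filter.mp hi).2.1⟩

/-- Exchange argument: an element of S of rank at least n forces exactly n elements of smaller rank,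
all with keys at least as large, and enough of them lie outside S to replace those of S. -/
theorem sum_le_sum_top (K : ℕ → ℚ) {A S : Finset ℕ} {n : ℕ} (hSA : S ⊆ A) (hS : S.card ≤ n) :
    ∑ i ∈ S, max (K i) 0 ≤ ∑ i ∈ top K A n, K i := by
  set T := A.filter fun i => rank K A i < n with hT
  have hTsum : ∑ i ∈ top K A n, K i = ∑ i ∈ T, max (K i) 0 := by
    have : top K A n = T.filter fun i => 0 < K i := by
      rw [hT, filter_filter]
      rfl
    rw [this, sum_filter]
    refine sum_congr rfl fun i _ => ?_
    split_ifs with h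
    · exact (max_eq_left h.le).symm
    · exact (max_eq_right (not_lt.mp h)).symm
  rw [hTsum]
  by_cases hsub : S ⊆ T
  · exact sum_le_sum_of_subset_of_nonneg hsub fun i _ _ => le_max_right _ _
  have hne : (S \ T).Nonempty := sdiff_nonempty.mpr hsub
  obtain ⟨j, hj, hjmax⟩ := exists_max_image (S \ T) (fun i => max (K i) 0) hne
  have hjA := hSA (mem_sdiff.mp hj).1
  have hjn : n ≤ rank K A j := by
    by_contra h
    exact (mem_sdiff.mp hj).2 (mem_filter.mpr ⟨hjA, not_le.mp h⟩)
  have hTcard : T.card = n := by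
    rw [hT, card_filter_rank_lt]
    exact min_eq_left (hjn.trans (rank_lt_card hjA).le)
  have hcard : (S \ T).card ≤ (T \ S).card := by
    have h1 := card_sdiff_add_card_inter S T
    have h2 := card_sdiff_add_card_inter T S
    rw [inter_comm] at h2
    omega
  rw [← sum_inter_add_sum_sdiff S T, ← sum_inter_add_sum_sdiff T S, inter_comm T S]
  refine add_le_add le_rfl ?_
  calc ∑ i ∈ S \ T, max (K i) 0 ≤ (S \ T).card • max (K j) 0 := sum_le_card_nsmul _ _ _ hjmax
    _ ≤ (T \ S).card • max (K j) 0 := nsmul_le_nsmul_left (le_max_right _ _) hcard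
    _ ≤ ∑ i ∈ T \ S, max (K i) 0 := by
      refine card_nsmul_le_sum _ _ _ fun i hi => max_le_max_right _ ?_
      exact key_le_of_rank_le hjA
        ((mem_filter.mp (mem_sdiff.mp hi).1).2.le.trans hjn)

/-! ### Bit lengths -/

/-- The larger of the bit lengths of the numerator and of the denominator. -/
def width (q : ℚ) : ℕ := max q.num.natAbs.size q.den.size

theorem width_le_bits (q : ℚ) : width q ≤ bits q := by
  unfold width bits
  omega

theorem bits_le_width (q : ℚ) : bits q ≤ 1 + 2 * width q := by
  unfold width bits
  omega

theorem size_mul_le (a b : ℕ) : (a * b).size ≤ a.size + b.size := by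
  rw [Nat.size_le, pow_add]
  exact Nat.mul_lt_mul'' (Nat.lt_size_self a) (Nat.lt_size_self b)

/-- Reduction to lowest terms only shrinks numerator and denominator, so any representing fraction
bounds the width. The rules for the arithmetic operations follow from this. -/
theorem width_divInt_le {n d : ℤ} (hd : d ≠ 0) {k : ℕ} (hn : n.natAbs.size ≤ k)
    (hd' : d.natAbs.size ≤ k) : width (n / d : ℚ) ≤ k := by
  refine max_le ((Nat.size_le_size ?_).trans hn) ((Nat.size_le_size ?_).trans hd')
  · rcases eq_or_ne n 0 with rfl | h
    · simp
    · rw [← Rat.divInt_eq_div]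
      exact Nat.le_of_dvd (Int.natAbs_pos.mpr h) (Int.natAbs_dvd_natAbs.mpr (Rat.num_dvd n hd))
  · rw [← Rat.divInt_eq_div]
    refine Nat.le_of_dvd (Int.natAbs_pos.mpr hd) ?_
    have := Int.natAbs_dvd_natAbs.mpr (Rat.den_dvd n d)
    simpa using this

theorem width_mul_le (a b : ℚ) : width (a * b) ≤ width a + width b := by
  have h : a * b = ((a.num * b.num : ℤ) : ℚ) / ((a.den * b.den : ℤ) : ℚ) := by
    conv_lhs => rw [← Rat.num_div_den a, ← Rat.num_div_den b]
    push_cast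
    rw [div_mul_div_comm]
  rw [h]
  refine width_divInt_le (by simp) ?_ ?_
  · rw [Int.natAbs_mul]
    exact (size_mul_le _ _).trans (add_le_add (le_max_left _ _) (le_max_left _ _))
  · rw [Int.natAbs_mul, Int.natAbs_natCast, Int.natAbs_natCast]
    exact (size_mul_le _ _).trans (add_le_add (le_max_right _ _) (le_max_right _ _))

theorem width_inv (a : ℚ) : width a⁻¹ ≤ width a := by
  rcases eq_or_ne a 0 with rfl | ha
  · simp
  have h : a⁻¹ = ((a.den : ℤ) : ℚ) / (a.num : ℚ) := by
    conv_lhs => rw [← Rat.num_div_den a]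
    rw [inv_div]
    simp
  rw [h]
  exact width_divInt_le (Rat.num_ne_zero.mpr ha) (by simp [width]) (le_max_left _ _)

theorem width_div_le (a b : ℚ) : width (a / b) ≤ width a + width b := by
  rw [div_eq_mul_inv]
  exact (width_mul_le _ _).trans (add_le_add le_rfl (width_inv b))

theorem width_neg (a : ℚ) : width (-a) = width a := by simp [width]

theorem width_add_le (a b : ℚ) : width (a + b) ≤ width a + width b + 1 := by
  have h : a + b = ((a.num * b.den + b.num * a.den : ℤ) : ℚ) / ((a.den * b.den : ℤ) : ℚ) := by
    conv_lhs => rw [← Rat.num_div_den a, ← Rat.num_div_den b]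
    have h1 : (a.den : ℚ) ≠ 0 := by simp
    have h2 : (b.den : ℚ) ≠ 0 := by simp
    push_cast
    rw [div_add_div _ _ h1 h2]
    ring
  rw [h]
  have hlt : ∀ {k l : ℕ}, k.size ≤ l → k < 2 ^ l := fun h => Nat.size_le.mp h
  refine width_divInt_le (by simp) ?_ ?_
  · rw [Nat.size_le, pow_succ]
    refine (Int.natAbs_add_le _ _).trans_lt ?_
    rw [Int.natAbs_mul, Int.natAbs_mul, Int.natAbs_natCast, Int.natAbs_natCast]
    have h1 : a.num.natAbs * b.den < 2 ^ (width a + width b) := hlt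
      ((size_mul_le _ _).trans (add_le_add (le_max_left _ _) (le_max_right _ _)))
    have h2 : b.num.natAbs * a.den < 2 ^ (width a + width b) := hlt
      ((size_mul_le _ _).trans (by
        rw [add_comm]; exact add_le_add (le_max_right _ _) (le_max_left _ _)))
    omega
  · rw [Int.natAbs_mul, Int.natAbs_natCast, Int.natAbs_natCast]
    exact ((size_mul_le _ _).trans (add_le_add (le_max_right _ _) (le_max_right _ _))).trans
      (Nat.le_succ _)

theorem width_sub_le (a b : ℚ) : width (a - b) ≤ width a + width b + 1 := by
  rw [sub_eq_add_neg]
  exact (width_add_le _ _).trans (by rw [width_neg])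

/-- This crude linear bound suffices: it is applied only to counters that are polynomial in `m`. -/
theorem width_natCast_le (k : ℕ) : width (k : ℚ) ≤ k + 1 := by
  unfold width
  have : k.size ≤ k := Nat.size_le.mpr Nat.lt_two_pow_self
  simp
  omega

theorem width_zero : width 0 = 1 := by simp [width]

theorem width_one : width 1 = 1 := by simp [width]

theorem width_sum_le (s : Finset ℕ) (f : ℕ → ℚ) {k : ℕ} (h : ∀ i ∈ s, width (f i) ≤ k) :
    width (∑ i ∈ s, f i) ≤ 1 + s.card * (k + 1) := by
  induction s using Finset.induction_on with
  | empty => simp [width_zero]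
  | insert i s hi ih =>
    rw [sum_insert hi, card_insert_of_notMem hi]
    have h1 := width_add_le (f i) (∑ i ∈ s, f i)
    have h2 := h i (mem_insert_self i s)
    have h3 := ih fun j hj => h j (mem_insert_of_mem hj)
    linarith

/-! ### Reasoning about programs -/

/-- The width of the value of an expression and its cost are bounded in terms of its weight. -/
def Arith.weight : Arith → ℕ
  | .const q => 1 + width q
  | .reg _ => 1
  | .arr _ e => 1 + e.weight
  | .add e f | .sub e f | .mul e f | .div e f => 1 + e.weight + f.weight

/-- The largest weight of an expression in the program. -/
def Program.weight : Program → ℕ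
  | .skip => 0
  | .setReg _ e => e.weight
  | .setArr _ e f => max e.weight f.weight
  | .seq P Q => max P.weight Q.weight
  | .ifLe e f P Q => max (max e.weight f.weight) (max P.weight Q.weight)
  | .whileLe e f P => max (max e.weight f.weight) P.weight

/-- All numbers in the memory have width at most `W`. -/
def Memory.Bounded (W : ℕ) (M : Memory) : Prop :=
  (∀ k, width (M.reg k) ≤ W) ∧ ∀ a i, width (M.arr a i) ≤ W

/-- The quantity width + 1 is subadditive under all four operations, which makes the bound linear in
the weight. An array access restarts from the memory bound, whatever the index. -/
theorem Arith.width_val_lt {W : ℕ} {M : Memory} (hM : M.Bounded W) (e : Arith) :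
    width (e.val M) + 1 ≤ e.weight * (W + 1) := by
  induction e with
  | const q =>
    simp only [Arith.val, Arith.weight]
    nlinarith [Nat.zero_le (width q * W)]
  | reg k =>
    have := hM.1 k
    simp only [Arith.val, Arith.weight]
    linarith
  | arr a e _ =>
    have := hM.2 a ⌊e.val M⌋₊
    simp only [Arith.val, Arith.weight]
    nlinarith [Nat.zero_le (e.weight * (W + 1))]
  | add e f he hf =>
    have := width_add_le (e.val M) (f.val M)
    simp only [Arith.val, Arith.weight]
    linarith
  | sub e f he hf =>
    have := width_sub_le (e.val M) (f.val M)
    simp only [Arith.val, Arith.weight]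
    linarith
  | mul e f he hf =>
    have := width_mul_le (e.val M) (f.val M)
    simp only [Arith.val, Arith.weight]
    linarith
  | div e f he hf =>
    have := width_div_le (e.val M) (f.val M)
    simp only [Arith.val, Arith.weight]
    linarith

theorem Arith.bits_val_le {W : ℕ} {M : Memory} (hM : M.Bounded W) (e : Arith) :
    bits (e.val M) ≤ 2 * e.weight * (W + 1) := by
  have h1 := e.width_val_lt hM
  have h2 := bits_le_width (e.val M)
  linarith

/-- One weight factor bounds the number of subexpressions, the other the size of each value. -/
theorem Arith.cost_le {W : ℕ} {M : Memory} (hM : M.Bounded W) (e : Arith) :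
    e.cost M ≤ 2 * e.weight ^ 2 * (W + 1) := by
  have key : ∀ a b c d B : ℕ, a ≤ 2 * b ^ 2 * B → c ≤ 2 * d ^ 2 * B → ∀ k,
      k ≤ 2 * (1 + b + d) * B → a + c + k ≤ 2 * (1 + b + d) ^ 2 * B := by
    intro a b c d B h1 h2 k h3
    nlinarith [Nat.zero_le (b * B), Nat.zero_le (d * B), Nat.zero_le (b * d * B)]
  induction e with
  | const q =>
    have h := (Arith.const q).bits_val_le hM
    simp only [Arith.val, Arith.cost, Arith.weight] at h ⊢
    nlinarith [Nat.zero_le (width q * (W + 1)), Nat.zero_le (width q ^ 2 * (W + 1))]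
  -- For a leaf, the cost is just the bit length of its value.
  | reg k =>
    have h := (Arith.reg k).bits_val_le hM
    simp only [Arith.val, Arith.cost, Arith.weight] at h ⊢
    linarith
  | arr a e he =>
    have h := (Arith.arr a e).bits_val_le hM
    exact key _ _ 0 0 _ he (Nat.zero_le _) _ h
  | add e f he hf => exact key _ _ _ _ _ he hf _ ((Arith.add e f).bits_val_le hM)
  | sub e f he hf => exact key _ _ _ _ _ he hf _ ((Arith.sub e f).bits_val_le hM)
  | mul e f he hf => exact key _ _ _ _ _ he hf _ ((Arith.mul e f).bits_val_le hM)
  | div e f he hf => exact key _ _ _ _ _ he hf _ ((Arith.div e f).bits_val_le hM)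

/-- An upper bound on the cost of one step of a program of weight at most `w`. -/
def stepCost (w W : ℕ) : ℕ := 1 + 4 * w ^ 2 * (W + 1)

theorem Arith.cost_add_cost_le {w W : ℕ} {M : Memory} (hM : M.Bounded W) {e f : Arith}
    (he : e.weight ≤ w) (hf : f.weight ≤ w) : 1 + e.cost M + f.cost M ≤ stepCost w W := by
  have h1 := e.cost_le hM
  have h2 := f.cost_le hM
  have h3 : 2 * e.weight ^ 2 * (W + 1) ≤ 2 * w ^ 2 * (W + 1) := by gcongr
  have h4 : 2 * f.weight ^ 2 * (W + 1) ≤ 2 * w ^ 2 * (W + 1) := by gcongr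
  unfold stepCost
  linarith

def Memory.setReg (M : Memory) (k : ℕ) (v : ℚ) : Memory :=
  { M with reg := Function.update M.reg k v }

def Memory.setArr (M : Memory) (a i : ℕ) (v : ℚ) : Memory :=
  { M with arr := Function.update M.arr a (Function.update (M.arr a) i v) }

@[simp] theorem Memory.reg_setReg (M : Memory) (k : ℕ) (v : ℚ) (j : ℕ) :
    (M.setReg k v).reg j = if j = k then v else M.reg j := by
  simp [Memory.setReg, Function.update_apply]

@[simp] theorem Memory.arr_setReg (M : Memory) (k : ℕ) (v : ℚ) : (M.setReg k v).arr = M.arr := rfl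

@[simp] theorem Memory.reg_setArr (M : Memory) (a i : ℕ) (v : ℚ) :
    (M.setArr a i v).reg = M.reg := rfl

@[simp] theorem Memory.arr_setArr (M : Memory) (a i : ℕ) (v : ℚ) (a' : ℕ) :
    (M.setArr a i v).arr a' = if a' = a then Function.update (M.arr a) i v else M.arr a' := by
  simp [Memory.setArr, Function.update_apply]

theorem Memory.Bounded.setReg {W : ℕ} {M : Memory} (hM : M.Bounded W) {v : ℚ} (hv : width v ≤ W)
    (k : ℕ) : (M.setReg k v).Bounded W := by
  refine ⟨fun j => ?_, hM.2⟩
  rw [Memory.reg_setReg]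
  split_ifs
  · exact hv
  · exact hM.1 j

theorem Memory.Bounded.setArr {W : ℕ} {M : Memory} (hM : M.Bounded W) {v : ℚ} (hv : width v ≤ W)
    (a i : ℕ) : (M.setArr a i v).Bounded W := by
  refine ⟨hM.1, fun a' j => ?_⟩
  rw [Memory.arr_setArr]
  split_ifs
  · rw [Function.update_apply]
    split_ifs
    · exact hv
    · exact hM.2 a j
  · exact hM.2 a' j

/-! ### A program logic with step counts and width bounds -/

/-- Started in `M`, the program makes at most `N` steps and ends with `Q`; all numbers have width
at most `W`, provided that this holds initially. -/
def Exec (w W : ℕ) (P : Program) (M : Memory) (N : ℕ) (Q : Memory → Prop) : Prop :=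
  P.weight ≤ w → M.Bounded W →
    ∃ M' t, Runs P M M' t ∧ t ≤ N * stepCost w W ∧ M'.Bounded W ∧ Q M'

namespace Exec

variable {w W N N' : ℕ} {P P' : Program} {M : Memory} {Q Q' : Memory → Prop}

theorem mono (h : Exec w W P M N Q) (hN : N ≤ N') (hQ : ∀ M', Q M' → Q' M') :
    Exec w W P M N' Q' := fun hw hM => by
  obtain ⟨M', t, h1, h2, h3, h4⟩ := h hw hM
  exact ⟨M', t, h1, h2.trans (Nat.mul_le_mul_right _ hN), h3, hQ M' h4⟩

theorem skip (h : Q M) : Exec w W .skip M 1 Q := fun _ hM =>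
  ⟨M, 1, .skip M, by rw [stepCost]; omega, hM, h⟩

theorem setReg {k : ℕ} {e : Arith} (hv : width (e.val M) ≤ W) (h : Q (M.setReg k (e.val M))) :
    Exec w W (.setReg k e) M 1 Q := fun hw hM => by
  -- The expression is counted twice to fit the two-expression form of the step cost.
  have hc := Arith.cost_add_cost_le hM (e := e) (f := e) hw hw
  exact ⟨_, _, .setReg k e M, by omega, hM.setReg hv k, h⟩

theorem setArr {a : ℕ} {i e : Arith} (hv : width (e.val M) ≤ W)
    (h : Q (M.setArr a ⌊i.val M⌋₊ (e.val M))) : Exec w W (.setArr a i e) M 1 Q := fun hw hM => by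
  have hc := Arith.cost_add_cost_le hM (max_le_iff.mp hw).1 (max_le_iff.mp hw).2
  exact ⟨_, _, .setArr a i e M, by omega, hM.setArr hv a _, h⟩

theorem seq (h : Exec w W P M N fun M' => Exec w W P' M' N' Q) :
    Exec w W (.seq P P') M (N + N') Q := fun hw hM => by
  obtain ⟨M', t, h1, h2, h3, h4⟩ := h (max_le_iff.mp hw).1 hM
  obtain ⟨M'', t', h1', h2', h3', h4'⟩ := h4 (max_le_iff.mp hw).2 h3
  exact ⟨M'', t + t', h1.seq h1', by rw [add_mul]; omega, h3', h4'⟩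

theorem ifLe {e f : Arith} (ht : e.val M ≤ f.val M → Exec w W P M N Q)
    (hf : f.val M < e.val M → Exec w W P' M N' Q) :
    Exec w W (.ifLe e f P P') M (1 + N + N') Q := fun hw hM => by
  have hw1 := max_le_iff.mp hw
  have hw2 := max_le_iff.mp hw1.1
  have hw3 := max_le_iff.mp hw1.2
  have hc := Arith.cost_add_cost_le hM hw2.1 hw2.2
  by_cases h : e.val M ≤ f.val M
  · obtain ⟨M', t, h1, h2, h3, h4⟩ := ht h hw3.1 hM
    refine ⟨M', _, .ifTrue h h1, ?_, h3, h4⟩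
    rw [add_mul, add_mul]
    omega
  · obtain ⟨M', t, h1, h2, h3, h4⟩ := hf (not_le.mp h) hw3.2 hM
    refine ⟨M', _, .ifFalse h h1, ?_, h3, h4⟩
    rw [add_mul, add_mul]
    omega

end Exec

/-- Add `1` to register `k`. -/
def increment (k : ℕ) : Program := .setReg k (.add (.reg k) (.const 1))

/-- For `k = 0, …, b - 1`, where `k` and `b` are registers. -/
def forLoop (k b : ℕ) (P : Program) : Program :=
  .seq (.setReg k (.const 0))
    -- Since tests are of the form ≤, the condition k < b reads k + 1 ≤ b.
    (.whileLe (.add (.reg k) (.const 1)) (.reg b) (.seq P (increment k)))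

/-- Each round costs the body, one test and one increment; the extra 2 is for the initialization and
the last, failing test. The invariant speaks of memories in which the counter is already set to the
current index. -/
theorem Exec.forLoop {w W N k b L : ℕ} {P : Program} {M : Memory} (hkb : b ≠ k)
    (hL : M.reg b = L) (hLW : L < W) (Inv : ℕ → Memory → Prop) (h0 : Inv 0 (M.setReg k 0))
    (hstep : ∀ i < L, ∀ M' : Memory, M'.reg k = (i : ℕ) → M'.reg b = (L : ℕ) → Inv i M' →
      Exec w W P M' N fun M'' => M''.reg k = i ∧ M''.reg b = L ∧
        Inv (i + 1) (M''.setReg k (i + 1 : ℕ))) :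
    Exec w W (forLoop k b P) M (2 + L * (N + 2)) fun M' => M'.reg b = L ∧ Inv L M' := by
  intro hw hM
  have hw1 := max_le_iff.mp hw
  have hw2 := max_le_iff.mp hw1.2
  have hw3 := max_le_iff.mp hw2.2
  have hw4 := max_le_iff.mp hw2.1
  have hloop : ∀ r i, i + r = L → ∀ M' : Memory, M'.reg k = (i : ℕ) → M'.reg b = (L : ℕ) → Inv i M' → M'.Bounded W →
      ∃ M'' t, Runs (.whileLe (.add (.reg k) (.const 1)) (.reg b) (.seq P (increment k))) M' M'' t ∧
        t ≤ (1 + r * (N + 2)) * stepCost w W ∧ M''.Bounded W ∧ M''.reg b = L ∧ Inv L M'' := by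
    intro r
    induction r with
    | zero =>
      intro i hi M' h1 h2 h3 h4
      obtain rfl : i = L := hi
      have hc := Arith.cost_add_cost_le h4 hw4.1 hw4.2
      refine ⟨M', _, .whileDone ?_, ?_, h4, h2, h3⟩
      · simp [Arith.val, h1, h2]
      · simpa using hc
    | succ r ih =>
      intro i hi M' h1 h2 h3 h4
      have hc := Arith.cost_add_cost_le h4 hw4.1 hw4.2
      obtain ⟨M₁, t₁, h5, h6, h7, h8, h9, h10⟩ := hstep i (by omega) M' h1 h2 h3 hw3.1 h4
      have hv : (Arith.add (.reg k) (.const 1)).val M₁ = ((i + 1 : ℕ) : ℚ) := by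
        simp [Arith.val, h8]
      have hb : width (((i + 1 : ℕ) : ℚ)) ≤ W := (width_natCast_le _).trans (by omega)
      have hinc : Exec w W (increment k) M₁ 1 fun M'' => M'' = M₁.setReg k (i + 1 : ℕ) :=
        Exec.setReg (hv ▸ hb) (by rw [hv])
      obtain ⟨M₂, t₂, h11, h12, h13, h14⟩ := hinc hw3.2 h7
      subst h14
      obtain ⟨M₃, t₃, h15, h16, h17, h18⟩ := ih (i + 1) (by omega) _ (by simp)
        (by simp [hkb, h9]) h10 h13
      refine ⟨M₃, _, .whileStep ?_ (h5.seq h11) h15, ?_, h17, h18⟩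
      · simp only [Arith.val, h1, h2]
        exact_mod_cast (by omega : i + 1 ≤ L)
      · have : (1 + (r + 1) * (N + 2)) * stepCost w W = stepCost w W + N * stepCost w W +
            1 * stepCost w W + (1 + r * (N + 2)) * stepCost w W := by ring
        omega
  have hset : Exec w W (.setReg k (.const 0)) M 1 fun M' => M' = M.setReg k 0 :=
    Exec.setReg (by simp only [Arith.val, width_zero]; omega) rfl
  obtain ⟨M₁, t₁, h1, h2, h3, h4⟩ := hset hw1.1 hM
  subst h4
  obtain ⟨M₂, t₂, h5, h6, h7, h8⟩ := hloop L 0 (by omega) _ (by simp) (by simp [hkb, hL]) h0 h3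
  refine ⟨M₂, _, h1.seq h5, ?_, h7, h8⟩
  have : (2 + L * (N + 2)) * stepCost w W = 1 * stepCost w W +
      (1 + L * (N + 2)) * stepCost w W := by ring
  omega

theorem rank_congr {K K' : ℕ → ℚ} {A : Finset ℕ} (h : ∀ j ∈ A, K j = K' j) {i : ℕ} (hi : i ∈ A) :
    rank K A i = rank K' A i := by
  unfold rank
  congr 1
  refine filter_congr fun j hj => ?_
  simp only [Precedes, h j hj, h i hi]

theorem rank_range_succ (K : ℕ → ℚ) (j i : ℕ) :
    rank K (range (j + 1)) i = rank K (range j) i + if Precedes K j i then 1 else 0 := by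
  unfold rank
  rw [range_add_one, filter_insert]
  split_ifs
  · rw [card_insert_of_notMem (by simp)]
  · rfl

theorem rank_range_le (K : ℕ → ℚ) (j i : ℕ) : rank K (range j) i ≤ j := by
  simpa [rank] using card_filter_le (range j) (fun k => Precedes K k i)

theorem mem_top_range {K : ℕ → ℚ} {m n i : ℕ} :
    i ∈ top K (range m) n ↔ i < m ∧ rank K (range m) i < n ∧ 0 < K i := by
  simp [top]

theorem top_congr {K K' : ℕ → ℚ} {A : Finset ℕ} (h : ∀ j ∈ A, K j = K' j) (n : ℕ) :
    top K A n = top K' A n := by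
  unfold top
  refine filter_congr fun j hj => ?_
  rw [rank_congr h hj, h j hj]

/-! ### The program

Registers: `3`, `4` and `10` are loop counters, `5` is a rank, `6` the threshold, `7` the total of
the selected keys, `8` the increment of the threshold, `9` the number of rounds, `11` the length of
the output. Array `4` holds keys, array `5` marks the selected options. -/

/-- With i in register 3 and j in register 4, a tie counts only if j < i; hence a strict comparison
of keys for i ≤ j and a weak one for j < i. -/
def rankStep : Program :=
  .ifLe (.reg 3) (.reg 4)
    (.ifLe (.arr 4 (.reg 4)) (.arr 4 (.reg 3)) .skip (increment 5))
    (.ifLe (.arr 4 (.reg 3)) (.arr 4 (.reg 4)) (increment 5) .skip)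

/-- Compute the rank of the option in register `3`. -/
def rankLoop : Program := .seq (.setReg 5 (.const 0)) (forLoop 4 0 rankStep)

/-- Compute the keys for the threshold. -/
def keyLoop : Program :=
  forLoop 3 0 (.setArr 4 (.reg 3) (.sub
    (.mul (.arr 0 (.reg 3)) (.sub (.arr 2 (.reg 3)) (.reg 6))) (.arr 1 (.reg 3))))

def selectStep : Program :=
  .seq (.setArr 5 (.reg 3) (.const 0))
    (.ifLe (.reg 1) (.reg 5) .skip
      (.ifLe (.arr 4 (.reg 3)) (.const 0) .skip
        (.seq (.setArr 5 (.reg 3) (.const 1)) (.setReg 7 (.add (.reg 7) (.arr 4 (.reg 3)))))))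

/-- Select the `n` largest keys, as far as these are positive. -/
def selectLoop : Program :=
  .seq (.setReg 7 (.const 0)) (forLoop 3 0 (.seq rankLoop selectStep))

def selectTop : Program := .seq keyLoop selectLoop

def thresholdLoop : Program :=
  forLoop 10 9 (.seq selectTop
    (.ifLe (.reg 7) (.reg 6) .skip (.setReg 6 (.add (.reg 6) (.reg 8)))))

/-- Compute the priorities of the selected options. -/
def priorityLoop : Program :=
  forLoop 3 0 (.ifLe (.const 1) (.arr 5 (.reg 3))
    (.setArr 4 (.reg 3) (.sub (.arr 3 (.reg 3)) (.div (.arr 1 (.reg 3)) (.arr 0 (.reg 3)))))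
    (.setArr 4 (.reg 3) (.const (-1))))

/-- List the options with non-negative key by decreasing key. -/
def sortLoop : Program :=
  .seq (.setReg 11 (.const 0)) (forLoop 3 0 (.seq rankLoop
    (.ifLe (.const 0) (.arr 4 (.reg 3))
      (.seq (.setArr 0 (.reg 5) (.reg 3)) (increment 11)) .skip)))

def outputLoop : Program := .seq priorityLoop (.seq sortLoop (.setReg 0 (.reg 11)))

def setIncrement : Program :=
  .seq (.setReg 9 (.mul (.mul (.const 2) (.add (.reg 0) (.const 1))) (.add (.reg 0) (.const 1))))
    (.setReg 8 (.div (.reg 7) (.reg 9)))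

def delegationProgram : Program :=
  .seq selectTop (.seq setIncrement (.seq thresholdLoop (.seq selectTop outputLoop)))

/-! ### Specifications of ranking, key computation and selection -/

section Spec

variable {w W : ℕ} {M : Memory}

theorem exec_increment {k v : ℕ} {Q : Memory → Prop} (hk : M.reg k = v) (hW : v + 2 ≤ W)
    (h : Q (M.setReg k (v + 1 : ℕ))) : Exec w W (increment k) M 1 Q := by
  have hv : (Arith.add (.reg k) (.const 1)).val M = ((v + 1 : ℕ) : ℚ) := by
    simp [Arith.val, hk]
  refine Exec.setReg ?_ ?_
  · rw [hv]
    exact (width_natCast_le _).trans (by omega)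
  · rw [hv]
    exact h

theorem exec_rankStep {i j v : ℕ} (hi : M.reg 3 = i) (hj : M.reg 4 = j) (hv : M.reg 5 = v)
    (hW : v + 2 ≤ W) {Q : Memory → Prop}
    (h1 : Precedes (M.arr 4) j i → Q (M.setReg 5 (v + 1 : ℕ)))
    (h2 : ¬ Precedes (M.arr 4) j i → Q M) : Exec w W rankStep M 7 Q := by
  refine Exec.ifLe (N := 3) (N' := 3) (fun h => ?_) fun h => ?_
  · simp only [Arith.val, hi, hj, Nat.cast_le] at h
    refine Exec.ifLe (N := 1) (N' := 1) (fun h' => ?_) fun h' => ?_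
    · simp only [Arith.val, hi, hj, Nat.floor_natCast] at h'
      refine Exec.skip (h2 ?_)
      rintro (h3 | h3)
      · exact absurd h' (not_le.mpr h3)
      · omega
    · simp only [Arith.val, hi, hj, Nat.floor_natCast] at h'
      exact exec_increment hv hW (h1 (Or.inl h'))
  · simp only [Arith.val, hi, hj, Nat.cast_lt] at h
    refine Exec.ifLe (N := 1) (N' := 1) (fun h' => ?_) fun h' => ?_
    · simp only [Arith.val, hi, hj, Nat.floor_natCast] at h'
      exact exec_increment hv hW (h1 (h'.lt_or_eq.imp id fun h3 => ⟨h3, h⟩))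
    · simp only [Arith.val, hi, hj, Nat.floor_natCast] at h'
      refine Exec.skip (h2 ?_)
      rintro (h3 | h3)
      · exact absurd h3 (not_lt.mpr h'.le)
      · exact absurd h3.1 h'.ne'

def rankSteps (m : ℕ) : ℕ := 3 + m * 9

theorem exec_rankLoop {m i : ℕ} (hm : M.reg 0 = m) (hi : M.reg 3 = i) (hmW : m < W) :
    Exec w W rankLoop M (rankSteps m) fun M' => M'.arr = M.arr ∧
      (∀ k, k ≠ 4 → k ≠ 5 → M'.reg k = M.reg k) ∧
      M'.reg 5 = rank (M.arr 4) (range m) i := by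
  refine Exec.mono (Exec.seq (N' := 2 + m * (7 + 2)) (Exec.setReg
    (by simp only [Arith.val, width_zero]; omega)
    (Exec.forLoop (by decide) (by simpa using hm) hmW (fun j M' => M'.arr = M.arr ∧
      (∀ k, k ≠ 4 → k ≠ 5 → M'.reg k = M.reg k) ∧
      M'.reg 5 = rank (M.arr 4) (range j) i) ?_ ?_))) ?_ fun M' h => h.2
  · refine ⟨rfl, fun k h4 h5 => by simp [h4, h5], by simp [Arith.val, rank]⟩
  · rintro j hj M' h4 h0 ⟨harr, hreg, hr⟩
    have h3 : M'.reg 3 = i := by rw [hreg 3 (by decide) (by decide), hi]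
    have hle := rank_range_le (M.arr 4) j i
    refine exec_rankStep h3 h4 hr (by omega) (fun hp => ?_) fun hp => ?_
    · rw [harr] at hp
      refine ⟨by simpa using h4, by simpa using h0, harr, fun k hk4 hk5 => ?_, ?_⟩
      · simp [hk4, hk5, hreg k]
      · simp [rank_range_succ, hp]
    · rw [harr] at hp
      refine ⟨h4, h0, harr, fun k hk4 hk5 => ?_, ?_⟩
      · simp [hk4, hk5, hreg k]
      · simp [rank_range_succ, hp, hr]
  · unfold rankSteps
    omega

/-- The key of option `i` for the threshold `τ`. -/
def key (A : ℕ → ℕ → ℚ) (τ : ℚ) (i : ℕ) : ℚ := A 0 i * (A 2 i - τ) - A 1 i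

theorem exec_keyLoop {m : ℕ} (hm : M.reg 0 = m) (hmW : m < W)
    (hW : ∀ i < m, width (key M.arr (M.reg 6) i) ≤ W) :
    Exec w W keyLoop M (2 + m * 3) fun M' =>
      (∀ a, a ≠ 4 → M'.arr a = M.arr a) ∧ (∀ k, k ≠ 3 → M'.reg k = M.reg k) ∧
      ∀ i < m, M'.arr 4 i = key M.arr (M.reg 6) i := by
  refine Exec.mono (Exec.forLoop (N := 1) (by decide) hm hmW (fun j M' =>
      (∀ a, a ≠ 4 → M'.arr a = M.arr a) ∧ (∀ k, k ≠ 3 → M'.reg k = M.reg k) ∧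
      ∀ i < j, M'.arr 4 i = key M.arr (M.reg 6) i) ?_ ?_) le_rfl fun M' h => h.2
  · exact ⟨fun _ _ => rfl, fun k hk => by simp [hk], fun i hi => absurd hi (Nat.not_lt_zero i)⟩
  · rintro j hj M' h3 h0 ⟨harr, hreg, hkey⟩
    have hv : (Arith.sub (.mul (.arr 0 (.reg 3)) (.sub (.arr 2 (.reg 3)) (.reg 6)))
        (.arr 1 (.reg 3))).val M' = key M.arr (M.reg 6) j := by
      simp [Arith.val, h3, harr, hreg, key]
    refine Exec.setArr (by rw [hv]; exact hW j hj) ?_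
    rw [hv]
    simp only [Arith.val, h3, Nat.floor_natCast]
    refine ⟨h3, h0, fun a ha => ?_, fun k hk => ?_, fun i hi => ?_⟩
    · simp [ha, harr]
    · simp [hk, hreg]
    · rcases Nat.lt_succ_iff_lt_or_eq.mp hi with hi | rfl
      · simp [hi.ne, hkey i hi]
      · simp

/-- The total of the selected keys. -/
def topSum (K : ℕ → ℚ) (m n : ℕ) : ℚ := ∑ i ∈ top K (range m) n, K i

def selectSteps (m : ℕ) : ℕ := 3 + m * (rankSteps m + 9)

theorem exec_selectLoop {m n v : ℕ} (hm : M.reg 0 = m) (hn : M.reg 1 = n) (hmW : m < W)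
    (hv1 : 1 ≤ v) (hv : ∀ i < m, width (M.arr 4 i) ≤ v) (hvW : 1 + m * (v + 1) ≤ W) :
    Exec w W selectLoop M (selectSteps m) fun M' =>
      (∀ a, a ≠ 5 → M'.arr a = M.arr a) ∧
      (∀ k, k ≠ 3 → k ≠ 4 → k ≠ 5 → k ≠ 7 → M'.reg k = M.reg k) ∧
      M'.reg 7 = topSum (M.arr 4) m n ∧
      ∀ i < m, M'.arr 5 i = if i ∈ top (M.arr 4) (range m) n then 1 else 0 := by
  set K := M.arr 4 with hK
  -- Register 7 runs through these partial sums, all of which must respect the width bound.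
  have hsumW : ∀ j ≤ m,
      width (∑ i ∈ range j, if i ∈ top K (range m) n then K i else 0) ≤ W := by
    intro j hj
    refine (width_sum_le _ _ (k := v) fun i hi => ?_).trans (le_trans ?_ hvW)
    · split_ifs
      · exact hv i ((mem_range.mp hi).trans_le hj)
      · rwa [width_zero]
    · rw [card_range]
      gcongr
  refine Exec.mono (Exec.seq (N' := 2 + m * (rankSteps m + 7 + 2)) (Exec.setReg
    (by simp only [Arith.val, width_zero]; omega)
    (Exec.forLoop (by decide) (by simpa using hm) hmW (fun j M' =>
      (∀ a, a ≠ 5 → M'.arr a = M.arr a) ∧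
      (∀ k, k ≠ 3 → k ≠ 4 → k ≠ 5 → k ≠ 7 → M'.reg k = M.reg k) ∧
      M'.reg 7 = (∑ i ∈ range j, if i ∈ top K (range m) n then K i else 0) ∧
      ∀ i < j, M'.arr 5 i = if i ∈ top K (range m) n then 1 else 0) ?_ ?_))) ?_ ?_
  · refine ⟨fun _ _ => rfl, fun k h3 _ _ h7 => by simp [h3, h7], by simp [Arith.val],
      fun i hi => absurd hi (Nat.not_lt_zero i)⟩
  · rintro i hi M' h3 h0 ⟨harr, hreg, h7, h5⟩
    refine Exec.seq ((exec_rankLoop h0 h3 hmW).mono le_rfl ?_)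
    rintro M₁ ⟨harr₁, hreg₁, hr⟩
    rw [harr 4 (by decide)] at hr
    have h3₁ : M₁.reg 3 = i := by rw [hreg₁ 3 (by decide) (by decide), h3]
    have h0₁ : M₁.reg 0 = m := by rw [hreg₁ 0 (by decide) (by decide), h0]
    have h1₁ : M₁.reg 1 = n := by
      rw [hreg₁ 1 (by decide) (by decide), hreg 1 (by decide) (by decide) (by decide) (by decide),
        hn]
    have h7₁ := (hreg₁ 7 (by decide) (by decide)).trans h7
    have hKi : M₁.arr 4 i = K i := by rw [harr₁, harr 4 (by decide)]
    have hmem := mem_top_range (K := K) (m := m) (n := n) (i := i)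
    -- Shared by the two rejecting branches: rank too large, or key not positive.
    have skip : i ∉ top K (range m) n → (M₁.setArr 5 i 0).reg 3 = i ∧
        (M₁.setArr 5 i 0).reg 0 = m ∧
        (∀ a, a ≠ 5 → ((M₁.setArr 5 i 0).setReg 3 (i + 1 : ℕ)).arr a = M.arr a) ∧
        (∀ k, k ≠ 3 → k ≠ 4 → k ≠ 5 → k ≠ 7 →
          ((M₁.setArr 5 i 0).setReg 3 (i + 1 : ℕ)).reg k = M.reg k) ∧
        ((M₁.setArr 5 i 0).setReg 3 (i + 1 : ℕ)).reg 7 =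
          (∑ i ∈ range (i + 1), if i ∈ top K (range m) n then K i else 0) ∧
        ∀ j < i + 1, ((M₁.setArr 5 i 0).setReg 3 (i + 1 : ℕ)).arr 5 j =
          if j ∈ top K (range m) n then 1 else 0 := by
      intro hnot
      refine ⟨h3₁, h0₁, fun a ha => ?_, fun k hk3 hk4 hk5 hk7 => ?_, ?_, fun j hj => ?_⟩
      · simp [ha, harr₁, harr]
      · simp [hk3, hk4, hk5, hreg₁, hreg, hk7]
      · rw [sum_range_succ, if_neg hnot, add_zero]
        simpa using h7₁
      · rcases Nat.lt_succ_iff_lt_or_eq.mp hj with hj | rfl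
        · simp [hj.ne, harr₁, h5 j hj]
        · simp [hnot]
    refine Exec.seq (N := 1) (N' := 6) (Exec.setArr
      (by simp only [Arith.val, width_zero]; omega) ?_)
    simp only [Arith.val, h3₁, Nat.floor_natCast]
    refine Exec.ifLe (N := 1) (N' := 4) (fun h => ?_) fun h => ?_
    · simp only [Arith.val, Memory.reg_setArr, h1₁, hr, Nat.cast_le] at h
      exact Exec.skip (skip fun h' => absurd (hmem.mp h').2.1 (not_lt.mpr h))
    simp only [Arith.val, Memory.reg_setArr, h1₁, hr, Nat.cast_lt] at h
    refine Exec.ifLe (N := 1) (N' := 2) (fun h' => ?_) fun h' => ?_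
    · simp only [Arith.val, Memory.reg_setArr, h3₁, Nat.floor_natCast, Memory.arr_setArr, hKi,
        Nat.reduceEqDiff, if_false] at h'
      exact Exec.skip (skip fun h'' => absurd (hmem.mp h'').2.2 (not_lt.mpr h'))
    simp only [Arith.val, Memory.reg_setArr, h3₁, Nat.floor_natCast, Memory.arr_setArr, hKi,
        Nat.reduceEqDiff, if_false] at h'
    have hin := hmem.mpr ⟨hi, h, h'⟩
    refine Exec.seq (N := 1) (N' := 1) (Exec.setArr
      (by simp only [Arith.val, width_one]; omega) ?_)
    simp only [Arith.val, Memory.reg_setArr, h3₁, Nat.floor_natCast]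
    have hval : (Arith.add (.reg 7) (.arr 4 (.reg 3))).val ((M₁.setArr 5 i 0).setArr 5 i 1) =
        ∑ i ∈ range (i + 1), if i ∈ top K (range m) n then K i else 0 := by
      rw [sum_range_succ, if_pos hin]
      simp [Arith.val, h3₁, hKi, h7₁]
    refine Exec.setReg (by rw [hval]; exact hsumW _ hi) ?_
    rw [hval]
    refine ⟨by simp [h3₁], by simp [h0₁], fun a ha => ?_, fun k hk3 hk4 hk5 hk7 => ?_, by simp,
      fun j hj => ?_⟩
    · simp [ha, harr₁, harr]
    · simp [hk3, hk4, hk5, hreg₁, hreg, hk7]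
    · rcases Nat.lt_succ_iff_lt_or_eq.mp hj with hj | rfl
      · simp [hj.ne, harr₁, h5 j hj]
      · simp [hin]
  · unfold selectSteps
    ring_nf
    omega
  · rintro M' ⟨-, harr, hreg, h7, h5⟩
    refine ⟨harr, hreg, ?_, h5⟩
    rw [h7, topSum, ← sum_filter]
    refine sum_congr ?_ fun _ _ => rfl
    ext i
    simp only [mem_filter, mem_range, mem_top_range]
    tauto

def topSteps (m : ℕ) : ℕ := 2 + m * 3 + selectSteps m

theorem exec_selectTop {m n v : ℕ} (hm : M.reg 0 = m) (hn : M.reg 1 = n) (hmW : m < W)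
    (hv1 : 1 ≤ v) (hv : ∀ i < m, width (key M.arr (M.reg 6) i) ≤ v)
    (hvW' : v ≤ W) (hvW : 1 + m * (v + 1) ≤ W) :
    Exec w W selectTop M (topSteps m) fun M' =>
      (∀ a, a ≠ 4 → a ≠ 5 → M'.arr a = M.arr a) ∧
      (∀ k, k ≠ 3 → k ≠ 4 → k ≠ 5 → k ≠ 7 → M'.reg k = M.reg k) ∧
      M'.reg 7 = topSum (key M.arr (M.reg 6)) m n ∧
      ∀ i < m, M'.arr 5 i = if i ∈ top (key M.arr (M.reg 6)) (range m) n then 1 else 0 := by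
  refine Exec.seq ((exec_keyLoop hm hmW fun i hi => (hv i hi).trans hvW').mono le_rfl ?_)
  rintro M₁ ⟨harr₁, hreg₁, hkey⟩
  have hcongr : ∀ j ∈ range m, M₁.arr 4 j = key M.arr (M.reg 6) j :=
    fun j hj => hkey j (mem_range.mp hj)
  refine (exec_selectLoop ((hreg₁ 0 (by decide)).trans hm) ((hreg₁ 1 (by decide)).trans hn) hmW hv1
    (fun i hi => by rw [hkey i hi]; exact hv i hi) hvW).mono le_rfl ?_
  rintro M₂ ⟨harr₂, hreg₂, h7, h5⟩
  rw [top_congr hcongr] at h5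
  refine ⟨fun a h4 h5 => (harr₂ a h5).trans (harr₁ a h4),
    fun k h3 h4 h5 h7 => (hreg₂ k h3 h4 h5 h7).trans (hreg₁ k h3), ?_, h5⟩
  rw [h7, topSum, topSum, top_congr hcongr]
  exact sum_congr rfl fun i hi => hcongr i (mem_filter.mp hi).1

end Spec

/-! ### The threshold -/

theorem key_congr {A A' : ℕ → ℕ → ℚ} (h : ∀ a < 4, A a = A' a) (τ : ℚ) : key A τ = key A' τ := by
  funext i
  simp [key, h]

theorem topSum_nonneg (K : ℕ → ℚ) (m n : ℕ) : 0 ≤ topSum K m n :=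
  sum_nonneg fun _ hi => (mem_top_range.mp hi).2.2.le

/-- The top set for τ' is a competitor for τ, and every key of an option with p_i ≥ 0 decreases in
the threshold. -/
theorem topSum_key_anti {A : ℕ → ℕ → ℚ} {m : ℕ} (n : ℕ) (h0 : ∀ i < m, 0 ≤ A 0 i) {τ τ' : ℚ}
    (h : τ ≤ τ') : topSum (key A τ') m n ≤ topSum (key A τ) m n := by
  refine le_trans (sum_le_sum fun i hi => ?_)
    (sum_le_sum_top (key A τ) (filter_subset _ _) (card_top_le (key A τ') (range m) n))
  refine le_max_of_le_left ?_
  have := mul_le_mul_of_nonneg_left h (h0 i (mem_top_range.mp hi).1)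
  unfold key
  linarith

/-- Lipschitz bound: each of at most m keys drops by p_i(τ' - τ) ≤ τ' - τ. -/
theorem topSum_key_le {A : ℕ → ℕ → ℚ} {m : ℕ} (n : ℕ) (h1 : ∀ i < m, A 0 i ≤ 1) {τ τ' : ℚ}
    (h : τ ≤ τ') : topSum (key A τ) m n ≤ topSum (key A τ') m n + m * (τ' - τ) := by
  have hcard : ((top (key A τ) (range m) n).card : ℚ) ≤ m := by
    have := card_filter_le (range m) fun i => rank (key A τ) (range m) i < n ∧ 0 < key A τ i
    rw [card_range] at this
    exact_mod_cast this
  calc topSum (key A τ) m n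
      ≤ ∑ i ∈ top (key A τ) (range m) n, (max (key A τ' i) 0 + (τ' - τ)) := by
        refine sum_le_sum fun i hi => ?_
        have h2 := mul_le_mul_of_nonneg_right (h1 i (mem_top_range.mp hi).1) (sub_nonneg.mpr h)
        have h3 := le_max_left (key A τ' i) 0
        unfold key at h3 ⊢
        linarith
    _ ≤ topSum (key A τ') m n + m * (τ' - τ) := by
        rw [sum_add_distrib, sum_const, nsmul_eq_mul]
        exact add_le_add (sum_le_sum_top _ (filter_subset _ _) (card_top_le _ _ _))
          (mul_le_mul_of_nonneg_right hcard (sub_nonneg.mpr h))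

/-- The number of rounds in which the threshold is increased. -/
def rounds (m : ℕ) : ℕ := 2 * (m + 1) * (m + 1)

/-- The threshold after `k` rounds: it is increased until it is at least the total of the selected
keys. -/
def threshold (A : ℕ → ℕ → ℚ) (m n : ℕ) : ℕ → ℚ
  | 0 => 0
  | k + 1 => if topSum (key A (threshold A m n k)) m n ≤ threshold A m n k then threshold A m n k
      else threshold A m n k + topSum (key A 0) m n / rounds m

section Threshold

variable (A : ℕ → ℕ → ℚ) (m n : ℕ)

/-- All thresholds are multiples of one step with a small multiplier, which bounds their width
directly. -/
theorem exists_threshold_eq (k : ℕ) :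
    ∃ j ≤ k, threshold A m n k = j * (topSum (key A 0) m n / rounds m) := by
  induction k with
  | zero => exact ⟨0, le_rfl, by simp [threshold]⟩
  | succ k ih =>
    obtain ⟨j, hj, h⟩ := ih
    rw [threshold]
    split_ifs
    · exact ⟨j, by omega, h⟩
    · refine ⟨j + 1, by omega, ?_⟩
      rw [h]
      push_cast
      ring

theorem threshold_eq_or (k : ℕ) :
    threshold A m n k = k * (topSum (key A 0) m n / rounds m) ∨
      topSum (key A (threshold A m n k)) m n ≤ threshold A m n k := by
  induction k with
  | zero => exact Or.inl (by simp [threshold])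
  | succ k ih =>
    rw [threshold]
    split_ifs with h
    · exact Or.inr h
    · left
      rw [ih.resolve_right h]
      push_cast
      ring

theorem increment_nonneg : 0 ≤ topSum (key A 0) m n / rounds m :=
  div_nonneg (topSum_nonneg _ _ _) (Nat.cast_nonneg _)

theorem threshold_nonneg (k : ℕ) : 0 ≤ threshold A m n k := by
  obtain ⟨j, -, h⟩ := exists_threshold_eq A m n k
  rw [h]
  exact mul_nonneg (Nat.cast_nonneg _) (increment_nonneg A m n)

variable {A m}

/-- Before a raise by δ the threshold is below g; the raise adds δ to it and lowers g by at most mδ.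
-/
theorem threshold_le_add (h1 : ∀ i < m, A 0 i ≤ 1) (k : ℕ) :
    threshold A m n k ≤ topSum (key A (threshold A m n k)) m n +
      (m + 1) * (topSum (key A 0) m n / rounds m) := by
  have hδ := increment_nonneg A m n
  induction k with
  | zero =>
    rw [threshold]
    have := topSum_nonneg (key A 0) m n
    positivity
  | succ k ih =>
    rw [threshold]
    split_ifs with h
    · exact ih
    · have := topSum_key_le (A := A) n h1 (le_add_of_nonneg_right hδ (a := threshold A m n k))
      rw [add_sub_cancel_left] at this
      linarith

/-- If the threshold is raised in every round, it ends at g(0), which dominates g there by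
monotonicity. -/
theorem topSum_threshold_le (h0 : ∀ i < m, 0 ≤ A 0 i) :
    topSum (key A (threshold A m n (rounds m))) m n ≤ threshold A m n (rounds m) := by
  rcases threshold_eq_or A m n (rounds m) with h | h
  · have hr : (rounds m : ℚ) ≠ 0 := by
      simp only [rounds, ne_eq, Nat.cast_eq_zero]
      positivity
    rw [mul_div_cancel₀ _ hr] at h
    rw [h]
    exact topSum_key_anti n h0 (topSum_nonneg _ _ _)
  · exact h

theorem threshold_le_two_mul (h0 : ∀ i < m, 0 ≤ A 0 i) (h1 : ∀ i < m, A 0 i ≤ 1) :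
    threshold A m n (rounds m) ≤ 2 * topSum (key A (threshold A m n (rounds m))) m n := by
  have h2 := topSum_threshold_le n h0
  have h3 := threshold_le_add n h1 (rounds m)
  have h4 := topSum_key_le n h1 (threshold_nonneg A m n (rounds m))
  have h5 : ((m : ℚ) + 1) * (topSum (key A 0) m n / rounds m) =
      topSum (key A 0) m n / (2 * (m + 1)) := by
    have : (m : ℚ) + 1 ≠ 0 := by positivity
    rw [rounds]
    push_cast
    field_simp
  -- Here g(0) ≤ g(τ) + mτ ≤ (m+1)τ, so the overshoot (m+1)δ = g(0)/(2(m+1)) is at most τ/2. The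
  -- number of rounds 2(m+1)² is chosen for this.
  have h6 : topSum (key A 0) m n / (2 * (m + 1)) ≤ threshold A m n (rounds m) / 2 := by
    rw [div_le_div_iff₀ (by positivity) two_pos]
    rw [sub_zero] at h4
    nlinarith
  linarith

end Threshold

/-! ### Correctness of the program -/

section Spec

variable {w W : ℕ} {M : Memory} {A : ℕ → ℕ → ℚ} {m n v : ℕ}

def thresholdSteps (m : ℕ) : ℕ := 2 + rounds m * (topSteps m + 5)

theorem exec_thresholdLoop (hA : ∀ a < 4, M.arr a = A a) (hm : M.reg 0 = m) (hn : M.reg 1 = n)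
    (h9 : M.reg 9 = rounds m) (h8 : M.reg 8 = topSum (key A 0) m n / rounds m) (h6 : M.reg 6 = 0)
    (hmW : m < W) (hrW : rounds m < W) (hv1 : 1 ≤ v) (hvW' : v ≤ W) (hvW : 1 + m * (v + 1) ≤ W)
    (hv : ∀ k, k ≤ rounds m → ∀ i < m, width (key A (threshold A m n k) i) ≤ v)
    (hW : ∀ k, k ≤ rounds m → width (threshold A m n k) ≤ W) :
    Exec w W thresholdLoop M (thresholdSteps m) fun M' =>
      (∀ a < 4, M'.arr a = A a) ∧ M'.reg 0 = m ∧ M'.reg 1 = n ∧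
      M'.reg 6 = threshold A m n (rounds m) := by
  refine Exec.mono (Exec.forLoop (N := topSteps m + 3) (by decide) h9 hrW (fun k M' =>
    (∀ a < 4, M'.arr a = A a) ∧ M'.reg 0 = m ∧ M'.reg 1 = n ∧
    M'.reg 6 = threshold A m n k ∧ M'.reg 8 = topSum (key A 0) m n / rounds m) ?_ ?_) le_rfl ?_
  · exact ⟨hA, by simp [hm], by simp [hn], by simp [h6, threshold], by simp [h8]⟩
  · rintro k hk M' h10 h9 ⟨hA', h0, h1, h6, h8⟩
    have hkey := key_congr hA' (M'.reg 6)
    rw [h6] at hkey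
    refine Exec.seq ((exec_selectTop h0 h1 hmW hv1
      (fun i hi => by rw [h6, hkey]; exact hv k hk.le i hi) hvW' hvW).mono le_rfl ?_)
    rintro M₁ ⟨harr, hreg, h7, -⟩
    rw [h6, hkey] at h7
    have h6₁ : M₁.reg 6 = threshold A m n k :=
      (hreg 6 (by decide) (by decide) (by decide) (by decide)).trans h6
    have h8₁ := (hreg 8 (by decide) (by decide) (by decide) (by decide)).trans h8
    have h0₁ := (hreg 0 (by decide) (by decide) (by decide) (by decide)).trans h0
    have h1₁ := (hreg 1 (by decide) (by decide) (by decide) (by decide)).trans h1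
    have h9₁ := (hreg 9 (by decide) (by decide) (by decide) (by decide)).trans h9
    have h10₁ := (hreg 10 (by decide) (by decide) (by decide) (by decide)).trans h10
    have hA₁ : ∀ a < 4, M₁.arr a = A a := fun a ha =>
      (harr a (by omega) (by omega)).trans (hA' a ha)
    refine Exec.ifLe (N := 1) (N' := 1) (fun h => ?_) fun h => ?_
    · simp only [Arith.val, h7, h6₁] at h
      refine Exec.skip ⟨h10₁, h9₁, hA₁, by simp [h0₁], by simp [h1₁], ?_, by simp [h8₁]⟩
      simp [threshold, h, h6₁]
    · simp only [Arith.val, h7, h6₁] at h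
      have hval : (Arith.add (.reg 6) (.reg 8)).val M₁ = threshold A m n (k + 1) := by
        simp [Arith.val, h6₁, h8₁, threshold, h]
      refine Exec.setReg (by rw [hval]; exact hW _ hk) ?_
      rw [hval]
      exact ⟨by simp [h10₁], by simp [h9₁], hA₁, by simp [h0₁], by simp [h1₁], by simp,
        by simp [h8₁]⟩
  · rintro M' ⟨-, hA', h0, h1, h6, -⟩
    exact ⟨hA', h0, h1, h6⟩

/-- The priorities of the selected options; the other options get a negative key. -/
def outputKey (A : ℕ → ℕ → ℚ) (T : Finset ℕ) (i : ℕ) : ℚ :=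
  if i ∈ T then A 3 i - A 1 i / A 0 i else -1

theorem exec_priorityLoop {T : Finset ℕ} (hA : ∀ a < 4, M.arr a = A a) (hm : M.reg 0 = m)
    (hmW : m < W) (h5 : ∀ i < m, M.arr 5 i = if i ∈ T then 1 else 0)
    (hW : ∀ i < m, width (A 3 i - A 1 i / A 0 i) ≤ W) :
    Exec w W priorityLoop M (2 + m * 5) fun M' =>
      M'.reg 0 = m ∧ ∀ i < m, M'.arr 4 i = outputKey A T i := by
  refine Exec.mono (Exec.forLoop (N := 3) (by decide) hm hmW (fun j M' =>
      (∀ a, a ≠ 4 → M'.arr a = M.arr a) ∧ ∀ i < j, M'.arr 4 i = outputKey A T i) ?_ ?_)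
      le_rfl fun M' h => ⟨h.1, h.2.2⟩
  · exact ⟨fun _ _ => rfl, fun i hi => absurd hi (Nat.not_lt_zero i)⟩
  · rintro j hj M' h3 h0 ⟨harr, hkey⟩
    have h5' : M'.arr 5 j = if j ∈ T then 1 else 0 := by rw [harr 5 (by decide), h5 j hj]
    have key : ∀ a, a = outputKey A T j →
        (M'.setArr 4 j a).reg 3 = j ∧ (M'.setArr 4 j a).reg 0 = m ∧
        (∀ a', a' ≠ 4 → ((M'.setArr 4 j a).setReg 3 (j + 1 : ℕ)).arr a' = M.arr a') ∧
        ∀ i < j + 1, ((M'.setArr 4 j a).setReg 3 (j + 1 : ℕ)).arr 4 i = outputKey A T i := by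
      rintro a rfl
      refine ⟨h3, h0, fun a ha => by simp [ha, harr], fun i hi => ?_⟩
      rcases Nat.lt_succ_iff_lt_or_eq.mp hi with hi | rfl
      · simp [hi.ne, hkey i hi]
      · simp
    refine Exec.ifLe (N := 1) (N' := 1) (fun h => ?_) fun h => ?_
    · simp only [Arith.val, h3, Nat.floor_natCast, h5'] at h
      have hj' : j ∈ T := by
        by_contra hj'
        rw [if_neg hj'] at h
        norm_num at h
      have hval : (Arith.sub (.arr 3 (.reg 3)) (.div (.arr 1 (.reg 3)) (.arr 0 (.reg 3)))).val M' =
          A 3 j - A 1 j / A 0 j := by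
        simp [Arith.val, h3, harr, hA]
      refine Exec.setArr (by rw [hval]; exact hW j hj) ?_
      rw [hval]
      simp only [Arith.val, h3, Nat.floor_natCast]
      exact key _ (by simp [outputKey, hj'])
    · simp only [Arith.val, h3, Nat.floor_natCast, h5'] at h
      have hj' : j ∉ T := by
        intro hj'
        rw [if_pos hj'] at h
        norm_num at h
      refine Exec.setArr (by simp only [Arith.val, width_neg, width_one]; omega) ?_
      simp only [Arith.val, h3, Nat.floor_natCast]
      exact key _ (by simp [outputKey, hj'])

def sortSteps (m : ℕ) : ℕ := 3 + m * (rankSteps m + 6)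

theorem exec_sortLoop (hm : M.reg 0 = m) (hmW : m < W) :
    Exec w W sortLoop M (sortSteps m) fun M' =>
      M'.reg 11 = ((range m).filter fun i => 0 ≤ M.arr 4 i).card ∧
      ∀ i < m, 0 ≤ M.arr 4 i → M'.arr 0 (rank (M.arr 4) (range m) i) = i := by
  set K := M.arr 4 with hK
  refine Exec.mono (Exec.seq (N' := 2 + m * (rankSteps m + 4 + 2)) (Exec.setReg
    (by simp only [Arith.val, width_zero]; omega)
    (Exec.forLoop (by decide) (by simpa using hm) hmW (fun j M' => M'.arr 4 = K ∧
      M'.reg 11 = ((range j).filter fun i => 0 ≤ K i).card ∧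
      ∀ i < j, 0 ≤ K i → M'.arr 0 (rank K (range m) i) = i) ?_ ?_))) ?_ fun M' h => h.2.2
  · exact ⟨rfl, by simp [Arith.val], fun i hi => absurd hi (Nat.not_lt_zero i)⟩
  · rintro j hj M' h3 h0 ⟨harr, h11, hout⟩
    refine Exec.seq (N' := 4) ((exec_rankLoop h0 h3 hmW).mono le_rfl ?_)
    rintro M₁ ⟨harr₁, hreg₁, hr⟩
    rw [harr] at hr
    have h3₁ := (hreg₁ 3 (by decide) (by decide)).trans h3
    have h0₁ := (hreg₁ 0 (by decide) (by decide)).trans h0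
    have h11₁ := (hreg₁ 11 (by decide) (by decide)).trans h11
    have hKj : M₁.arr 4 j = K j := by rw [harr₁, harr]
    have hcard : ((range j).filter fun i => 0 ≤ K i).card ≤ j := by
      simpa using card_filter_le (range j) fun i => 0 ≤ K i
    refine Exec.ifLe (N := 2) (N' := 1) (fun h => ?_) fun h => ?_
    · simp only [Arith.val, h3₁, Nat.floor_natCast, hKj] at h
      refine Exec.seq (N := 1) (N' := 1) (Exec.setArr ?_ ?_)
      · simp only [Arith.val, h3₁]
        exact (width_natCast_le _).trans (by omega)
      · simp only [Arith.val, h3₁, hr, Nat.floor_natCast]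
        refine exec_increment h11₁ (by omega) ⟨by simp [h3₁], by simp [h0₁], ?_, ?_, ?_⟩
        · simp [harr₁, harr]
        · rw [range_add_one, filter_insert, if_pos h, card_insert_of_notMem (by simp)]
          simp
        · intro i hi hKi
          rcases Nat.lt_succ_iff_lt_or_eq.mp hi with hi | rfl
          -- Distinct indices have distinct ranks, so a later write never destroys an earlier one.
          · have hne : rank K (range m) i ≠ rank K (range m) j := fun h' => hi.ne
              (rank_injOn K (range m) (by simpa using hi.trans hj) (by simpa using hj) h')
            simp [hne, harr₁, hout i hi hKi]
          · simp
    · simp only [Arith.val, h3₁, Nat.floor_natCast, hKj] at h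
      refine Exec.skip ⟨h3₁, h0₁, ?_, ?_, ?_⟩
      · simp [harr₁, harr]
      · rw [range_add_one, filter_insert, if_neg (not_le.mpr h)]
        simpa using h11₁
      · intro i hi hKi
        rcases Nat.lt_succ_iff_lt_or_eq.mp hi with hi | rfl
        · simp [harr₁, hout i hi hKi]
        · exact absurd hKi (not_le.mpr h)
  · unfold sortSteps
    ring_nf
    omega

/-- Unselected options have key -1, below the non-negative priorities of selected ones, so they
never precede them. -/
theorem rank_outputKey {T : Finset ℕ} (hT : T ⊆ range m)
    (h0 : ∀ i ∈ T, 0 ≤ A 3 i - A 1 i / A 0 i) {i : ℕ} (hi : i ∈ T) :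
    rank (outputKey A T) (range m) i = rank (fun i => A 3 i - A 1 i / A 0 i) T i := by
  unfold rank
  congr 1
  ext j
  simp only [mem_filter]
  constructor
  · rintro ⟨-, hj⟩
    have hjT : j ∈ T := by
      by_contra hjT
      have := h0 i hi
      simp only [Precedes, outputKey, hi, hjT, if_true, if_false] at hj
      rcases hj with hj | hj <;> linarith
    refine ⟨hjT, ?_⟩
    simpa [Precedes, outputKey, hi, hjT] using hj
  · rintro ⟨hj, h⟩
    refine ⟨hT hj, ?_⟩
    simpa [Precedes, outputKey, hi, hj] using h

def outputSteps (m : ℕ) : ℕ := 2 + m * 5 + (sortSteps m + 1)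

theorem exec_outputLoop {T : Finset ℕ} (hT : T ⊆ range m) (hA : ∀ a < 4, M.arr a = A a)
    (hm : M.reg 0 = m) (hmW : m < W) (h5 : ∀ i < m, M.arr 5 i = if i ∈ T then 1 else 0)
    (hW : ∀ i < m, width (A 3 i - A 1 i / A 0 i) ≤ W)
    (h0 : ∀ i ∈ T, 0 ≤ A 3 i - A 1 i / A 0 i) :
    Exec w W outputLoop M (outputSteps m) fun M' => M'.reg 0 = T.card ∧
      ∀ i ∈ T, M'.arr 0 (rank (fun i => A 3 i - A 1 i / A 0 i) T i) = i := by
  refine Exec.seq ((exec_priorityLoop hA hm hmW h5 hW).mono le_rfl ?_)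
  rintro M₁ ⟨hm₁, hkey⟩
  refine Exec.seq ((exec_sortLoop hm₁ hmW).mono le_rfl ?_)
  rintro M₂ ⟨h11, hout⟩
  have hmem : ∀ i, i < m ∧ 0 ≤ M₁.arr 4 i ↔ i ∈ T := by
    intro i
    constructor
    · rintro ⟨hi, h⟩
      by_contra hiT
      rw [hkey i hi, outputKey, if_neg hiT] at h
      norm_num at h
    · intro hi
      have him := mem_range.mp (hT hi)
      refine ⟨him, ?_⟩
      rw [hkey i him, outputKey, if_pos hi]
      exact h0 i hi
  have hfilter : ((range m).filter fun i => 0 ≤ M₁.arr 4 i) = T := by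
    ext i
    rw [mem_filter, mem_range]
    exact hmem i
  rw [hfilter] at h11
  refine Exec.setReg ?_ ⟨by simp [Arith.val, h11], fun i hi => ?_⟩
  · simp only [Arith.val, h11]
    have := card_le_card hT
    rw [card_range] at this
    exact (width_natCast_le _).trans (by omega)
  · obtain ⟨him, h⟩ := (hmem i).mpr hi
    have := hout i him h
    rw [rank_congr (fun j hj => hkey j (mem_range.mp hj)) (mem_range.mpr him),
      rank_outputKey hT h0 hi] at this
    simpa using this

def delegationSteps (m : ℕ) : ℕ :=
  topSteps m + (1 + 1 + (thresholdSteps m + (topSteps m + outputSteps m)))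

theorem exec_delegationProgram (hm : M.reg 0 = m) (hn : M.reg 1 = n) (h6 : M.reg 6 = 0)
    (hmW : m < W) (hrW : rounds m < W) (hv1 : 1 ≤ v) (hvW' : v ≤ W) (hvW : 1 + m * (v + 1) ≤ W)
    (hv : ∀ k, k ≤ rounds m → ∀ i < m, width (key M.arr (threshold M.arr m n k) i) ≤ v)
    (hW : ∀ k, k ≤ rounds m → width (threshold M.arr m n k) ≤ W)
    (hδW : width (topSum (key M.arr 0) m n / rounds m) ≤ W)
    (hwW : ∀ i < m, width (M.arr 3 i - M.arr 1 i / M.arr 0 i) ≤ W)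
    (h0 : ∀ i < m, 0 ≤ M.arr 3 i - M.arr 1 i / M.arr 0 i) :
    Exec w W delegationProgram M (delegationSteps m) fun M' =>
      M'.reg 0 = (top (key M.arr (threshold M.arr m n (rounds m))) (range m) n).card ∧
      ∀ i ∈ top (key M.arr (threshold M.arr m n (rounds m))) (range m) n,
        M'.arr 0 (rank (fun i => M.arr 3 i - M.arr 1 i / M.arr 0 i)
          (top (key M.arr (threshold M.arr m n (rounds m))) (range m) n) i) = i := by
  refine Exec.seq ((exec_selectTop hm hn hmW hv1 (fun i hi => ?_) hvW' hvW).mono le_rfl ?_)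
  · rw [h6]
    exact hv 0 (Nat.zero_le _) i hi
  rintro M₁ ⟨harr₁, hreg₁, h7, -⟩
  rw [h6] at h7
  have hA₁ : ∀ a < 4, M₁.arr a = M.arr a := fun a ha => harr₁ a (by omega) (by omega)
  have h0₁ := (hreg₁ 0 (by decide) (by decide) (by decide) (by decide)).trans hm
  have h1₁ := (hreg₁ 1 (by decide) (by decide) (by decide) (by decide)).trans hn
  have h6₁ := (hreg₁ 6 (by decide) (by decide) (by decide) (by decide)).trans h6
  have hv9 : (Arith.mul (.mul (.const 2) (.add (.reg 0) (.const 1)))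
      (.add (.reg 0) (.const 1))).val M₁ = rounds m := by
    simp [Arith.val, h0₁, rounds]
  refine Exec.seq (Exec.seq (Exec.setReg ?_ ?_))
  · rw [hv9]
    exact (width_natCast_le _).trans hrW
  rw [hv9]
  have hv8 : (Arith.div (.reg 7) (.reg 9)).val (M₁.setReg 9 (rounds m)) =
      topSum (key M.arr 0) m n / rounds m := by
    simp [Arith.val, h7]
  refine Exec.setReg (by rw [hv8]; exact hδW) ?_
  rw [hv8]
  refine Exec.seq ((exec_thresholdLoop
    (M := (M₁.setReg 9 (rounds m)).setReg 8 (topSum (key M.arr 0) m n / rounds m))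
    (A := M.arr) (m := m) (n := n) (v := v) hA₁
    (by simp [h0₁]) (by simp [h1₁]) (by simp) (by simp) (by simp [h6₁]) hmW hrW hv1 hvW' hvW hv hW).mono le_rfl ?_)
  rintro M₂ ⟨hA₂, h0₂, h1₂, h6₂⟩
  have hkey := key_congr hA₂ (M₂.reg 6)
  rw [h6₂] at hkey
  refine Exec.seq ((exec_selectTop h0₂ h1₂ hmW hv1 (fun i hi => ?_) hvW' hvW).mono le_rfl ?_)
  · rw [h6₂, hkey]
    exact hv _ le_rfl i hi
  rintro M₃ ⟨harr₃, hreg₃, -, h5⟩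
  rw [h6₂, hkey] at h5
  exact exec_outputLoop (filter_subset _ _)
    (fun a ha => (harr₃ a (by omega) (by omega)).trans (hA₂ a ha))
    ((hreg₃ 0 (by decide) (by decide) (by decide) (by decide)).trans h0₂) hmW h5 hwW
    fun i hi => h0 i (mem_top_range.mp hi).1

end Spec

/-! ### Size of the input and running time -/

section Input

variable {m : ℕ} (d : RationalData m) (n : ℕ) (ε : ℚ)

theorem bits_le_inputSize (i : Fin m) :
    bits (d.p i) ≤ inputSize d n ε ∧ bits (d.c i) ≤ inputSize d n ε ∧
      bits (d.x i) ≤ inputSize d n ε ∧ bits (d.y i) ≤ inputSize d n ε := by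
  have h := single_le_sum (f := fun i => bits (d.p i) + bits (d.c i) + bits (d.x i) + bits (d.y i))
    (fun _ _ => Nat.zero_le _) (mem_univ i)
  unfold inputSize
  omega

theorem le_inputSize : m ≤ inputSize d n ε := by
  have h := card_nsmul_le_sum univ
    (fun i => bits (d.p i) + bits (d.c i) + bits (d.x i) + bits (d.y i)) 1
    (fun i _ => by unfold bits; omega)
  simp only [card_univ, Fintype.card_fin, smul_eq_mul, mul_one] at h
  unfold inputSize
  omega

theorem one_le_inputSize : 1 ≤ inputSize d n ε := by
  unfold inputSize bits
  omega

theorem bounded_inputMemory : (inputMemory d n ε).Bounded (inputSize d n ε) := by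
  have h0 : width 0 ≤ inputSize d n ε := by
    rw [width_zero]
    exact one_le_inputSize d n ε
  refine ⟨fun k => ?_, fun a i => ?_⟩
  · have h1 := width_le_bits m
    have h2 := width_le_bits n
    have h3 := width_le_bits ε
    simp only [inputMemory]
    split_ifs
    · unfold inputSize; omega
    · unfold inputSize; omega
    · unfold inputSize; omega
    · exact h0
  · simp only [inputMemory]
    split_ifs with hi
    · exact (width_le_bits _).trans (bits_le_inputSize d n ε _).1
    · exact (width_le_bits _).trans (bits_le_inputSize d n ε _).2.1
    · exact (width_le_bits _).trans (bits_le_inputSize d n ε _).2.2.1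
    · exact (width_le_bits _).trans (bits_le_inputSize d n ε _).2.2.2
    · exact h0
    · exact h0

end Input

/-- A bound on the width of the thresholds. -/
def thresholdWidth (s : ℕ) : ℕ := rounds s + 1 + (1 + s * (3 * s + 4) + (rounds s + 1))

/-- A bound on the width of the keys. -/
def keyWidth (s : ℕ) : ℕ := 3 * s + 2 + thresholdWidth s

/-- A bound on the width of all numbers. -/
def memoryWidth (s : ℕ) : ℕ := 2 + thresholdWidth s + (s + 1) * (keyWidth s + 1)

def runningTime (s : ℕ) : ℕ :=
  delegationSteps s * stepCost delegationProgram.weight (memoryWidth s)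

theorem rounds_mono {m s : ℕ} (h : m ≤ s) : rounds m ≤ rounds s := by
  unfold rounds
  gcongr

theorem delegationSteps_mono {m s : ℕ} (h : m ≤ s) : delegationSteps m ≤ delegationSteps s := by
  have := rounds_mono h
  simp only [delegationSteps, topSteps, thresholdSteps, outputSteps, selectSteps, sortSteps,
    rankSteps]
  gcongr

def IsPolynomial (f : ℕ → ℕ) : Prop := ∃ T : Polynomial ℕ, ∀ s, T.eval s = f s

namespace IsPolynomial

variable {f g : ℕ → ℕ}

theorem const (k : ℕ) : IsPolynomial fun _ => k := ⟨.C k, fun s => by simp⟩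

theorem id : IsPolynomial fun s => s := ⟨.X, fun s => by simp⟩

theorem add : IsPolynomial f → IsPolynomial g → IsPolynomial fun s => f s + g s :=
  fun ⟨T, hT⟩ ⟨U, hU⟩ => ⟨T + U, fun s => by simp [hT, hU]⟩

theorem mul : IsPolynomial f → IsPolynomial g → IsPolynomial fun s => f s * g s :=
  fun ⟨T, hT⟩ ⟨U, hU⟩ => ⟨T * U, fun s => by simp [hT, hU]⟩

end IsPolynomial

theorem isPolynomial_runningTime : IsPolynomial runningTime := by
  have c := IsPolynomial.const
  have X := IsPolynomial.id
  have hrounds : IsPolynomial rounds := ((c 2).mul (X.add (c 1))).mul (X.add (c 1))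
  have hthr : IsPolynomial thresholdWidth := (hrounds.add (c 1)).add
    (((c 1).add (X.mul (((c 3).mul X).add (c 4)))).add (hrounds.add (c 1)))
  have hkey : IsPolynomial keyWidth := (((c 3).mul X).add (c 2)).add hthr
  have hmem : IsPolynomial memoryWidth :=
    ((c 2).add hthr).add ((X.add (c 1)).mul (hkey.add (c 1)))
  have hrank : IsPolynomial rankSteps := (c 3).add (X.mul (c 9))
  have hselect : IsPolynomial selectSteps := (c 3).add (X.mul (hrank.add (c 9)))
  have hsort : IsPolynomial sortSteps := (c 3).add (X.mul (hrank.add (c 6)))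
  have htop : IsPolynomial topSteps := ((c 2).add (X.mul (c 3))).add hselect
  have hloop : IsPolynomial thresholdSteps := (c 2).add (hrounds.mul (htop.add (c 5)))
  have hout : IsPolynomial outputSteps := ((c 2).add (X.mul (c 5))).add (hsort.add (c 1))
  have hsteps : IsPolynomial delegationSteps :=
    htop.add (((c 1).add (c 1)).add (hloop.add (htop.add hout)))
  exact hsteps.mul ((c 1).add ((c (4 * delegationProgram.weight ^ 2)).mul (hmem.add (c 1))))

theorem width_key_le {A : ℕ → ℕ → ℚ} {s : ℕ} (hA : ∀ a i, width (A a i) ≤ s) (τ : ℚ) (i : ℕ) :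
    width (key A τ i) ≤ 3 * s + 2 + width τ := by
  have h1 := width_sub_le (A 0 i * (A 2 i - τ)) (A 1 i)
  have h2 := width_mul_le (A 0 i) (A 2 i - τ)
  have h3 := width_sub_le (A 2 i) τ
  have h4 := hA 0 i
  have h5 := hA 1 i
  have h6 := hA 2 i
  unfold key
  omega

theorem width_increment_le {A : ℕ → ℕ → ℚ} {m s : ℕ} (n : ℕ) (hA : ∀ a i, width (A a i) ≤ s)
    (hm : m ≤ s) :
    width (topSum (key A 0) m n / rounds m) ≤ 1 + s * (3 * s + 4) + (rounds s + 1) := by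
  refine (width_div_le _ _).trans (add_le_add ?_ ?_)
  -- A key at threshold 0 has width at most 3s + 2 + 1, since 0 itself has width 1.
  · refine (width_sum_le _ _ (k := 3 * s + 3) fun i _ => ?_).trans ?_
    · simpa [width_zero] using width_key_le hA 0 i
    · have : (top (key A 0) (range m) n).card ≤ s := by
        refine (card_le_card (filter_subset _ _)).trans ?_
        rwa [card_range]
      gcongr
  · exact (width_natCast_le _).trans (Nat.succ_le_succ (rounds_mono hm))

theorem width_threshold_le {A : ℕ → ℕ → ℚ} {m s : ℕ} (n : ℕ) (hA : ∀ a i, width (A a i) ≤ s)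
    (hm : m ≤ s) {k : ℕ} (hk : k ≤ rounds m) :
    width (threshold A m n k) ≤ thresholdWidth s := by
  obtain ⟨j, hj, h⟩ := exists_threshold_eq A m n k
  rw [h]
  refine (width_mul_le _ _).trans (add_le_add ?_ (width_increment_le n hA hm))
  exact (width_natCast_le _).trans (Nat.succ_le_succ ((hj.trans hk).trans (rounds_mono hm)))

/-! ### The computed set -/

/-- The options that the program selects. -/
def selected (A : ℕ → ℕ → ℚ) (m n : ℕ) : Finset ℕ :=
  top (key A (threshold A m n (rounds m))) (range m) n

theorem lt_of_mem_selected {A : ℕ → ℕ → ℚ} {m n : ℕ} : ∀ i ∈ selected A m n, i < m :=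
  fun _ hi => (mem_top_range.mp hi).1

theorem Instance.attains_selected {m : ℕ} (I : Instance m) (n : ℕ) {A : ℕ → ℕ → ℚ}
    (hp : ∀ i : Fin m, I.p i = A 0 i) (hc : ∀ i : Fin m, I.c i = A 1 i)
    (hx : ∀ i : Fin m, I.x i = A 2 i) {ρ : ℝ} (hρ : ρ ≤ 1 / 3) :
    I.Attains n ((selected A m n).attachFin lt_of_mem_selected) ρ := by
  set τ := threshold A m n (rounds m) with hτ
  have h0 : ∀ i < m, 0 ≤ A 0 i := fun i hi => by
    have := I.p_pos ⟨i, hi⟩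
    rw [hp] at this
    exact_mod_cast this.le
  have h1 : ∀ i < m, A 0 i ≤ 1 := fun i hi => by
    have := I.p_le_one ⟨i, hi⟩
    rw [hp] at this
    exact_mod_cast this
  have hkey : ∀ i : Fin m, I.p i * (I.x i - τ) - I.c i = (key A τ i : ℚ) := fun i => by
    rw [hp, hc, hx, key]
    push_cast
    rfl
  have hg1 : ((topSum (key A τ) m n : ℚ) : ℝ) ≤ τ := by
    exact_mod_cast topSum_threshold_le n h0
  have hg2 : (τ : ℝ) ≤ 2 * (topSum (key A τ) m n : ℚ) := by
    exact_mod_cast threshold_le_two_mul n h0 h1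
  -- From g ≤ τ ≤ 2g, both τ and g are at least (τ + g)/3.
  refine I.attains_of_threshold (τ := τ) (g := (topSum (key A τ) m n : ℚ)) (ρ := 1 / 3)
    ?_ ?_ ?_ ?_ (by norm_num) hρ (by linarith) ?_
  · rw [card_attachFin]
    exact card_top_le _ _ _
  · exact_mod_cast threshold_nonneg A m n _
  · intro S hS
    have := sum_le_sum_top (key A τ) (A := range m) (S := S.map Fin.valEmbedding) (n := n)
      (fun i hi => by
        obtain ⟨j, -, rfl⟩ := mem_map.mp hi
        simp) (by rwa [card_map])
    rw [sum_map] at this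
    simp only [hkey]
    exact_mod_cast this
  · intro i hi
    rw [hkey]
    exact_mod_cast (mem_top_range.mp ((mem_attachFin _).mp hi)).2.2.le
  · simp only [hkey]
    have : ∑ i ∈ (selected A m n).attachFin lt_of_mem_selected, (key A τ i : ℝ) =
        (topSum (key A τ) m n : ℚ) := by
      have h : ((selected A m n).attachFin lt_of_mem_selected).map Fin.valEmbedding =
          selected A m n := by
        ext i
        simp only [mem_map, mem_attachFin, Fin.valEmbedding_apply]
        exact ⟨fun ⟨j, hj, h⟩ => h ▸ hj, fun hi => ⟨⟨i, lt_of_mem_selected i hi⟩, hi, rfl⟩⟩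
      have h' : topSum (key A τ) m n =
          ∑ i ∈ ((selected A m n).attachFin lt_of_mem_selected).map Fin.valEmbedding,
            key A τ i := by
        rw [h]
        rfl
      rw [h', sum_map]
      push_cast
      rfl
    rw [this]
    linarith

/-- The k-th entry is the unique element of rank k, which is where the program writes it. -/
theorem exists_list_rank (K : ℕ → ℚ) {m : ℕ} {T : Finset ℕ} (hT : ∀ i ∈ T, i < m) :
    ∃ l : List (Fin m), l.Nodup ∧ l.toFinset = T.attachFin hT ∧
      l.Pairwise (fun i j : Fin m => K j ≤ K i) ∧ l.length = T.card ∧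
      ∀ (k : ℕ) (h : k < l.length), ((l[k] : Fin m) : ℕ) ∈ T ∧ rank K T (l[k] : Fin m) = k := by
  have hex : ∀ k : Fin T.card, ∃ i ∈ T, rank K T i = k := fun k => by
    have : (k : ℕ) ∈ T.image (rank K T) := by
      rw [image_rank]
      exact mem_range.mpr k.2
    exact mem_image.mp this
  choose f hfT hf using hex
  refine ⟨List.ofFn fun k => ⟨f k, hT _ (hfT k)⟩, ?_, ?_, ?_, by simp, ?_⟩
  · rw [List.nodup_ofFn]
    intro k k' h
    have h : f k = f k' := by simpa using h
    exact Fin.ext (by rw [← hf k, ← hf k', h])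
  · ext i
    rw [List.mem_toFinset, List.mem_ofFn, mem_attachFin]
    constructor
    · rintro ⟨k, rfl⟩
      exact hfT k
    · intro hi
      refine ⟨⟨rank K T i, rank_lt_card hi⟩, Fin.ext ?_⟩
      exact rank_injOn K T (hfT _) hi (hf _)
  · rw [List.pairwise_ofFn]
    intro k k' h
    refine key_le_of_rank_le (hfT k') ?_
    rw [hf, hf]
    exact h.le
  · intro k h
    simp only [List.getElem_ofFn]
    exact ⟨hfT _, hf _⟩

/-- Stated for any `s` above the input size, so that the term for 1/ε can be added to the time bound
at no cost. -/
theorem exists_runs_delegationProgram {m : ℕ} (n : ℕ) (ε : ℚ) (I : Instance m)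
    (d : RationalData m) (hd : d.Describes I) {s : ℕ} (hs : inputSize d n ε ≤ s) {ρ : ℝ}
    (hρ : ρ ≤ 1 / 3) :
    ∃ (M : Memory) (t : ℕ) (R : Finset (Fin m)) (l : List (Fin m)),
      Runs delegationProgram (inputMemory d n ε) M t ∧ t ≤ runningTime s ∧
      M.Outputs l ∧ I.IsPriorityOrder R l ∧ I.Attains n R ρ := by
  set M₀ := inputMemory d n ε with hM₀
  set A := M₀.arr with hA
  have hp : ∀ i : Fin m, I.p i = A 0 i := fun i => by simp [hA, hM₀, inputMemory, (hd i).1]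
  have hc : ∀ i : Fin m, I.c i = A 1 i := fun i => by simp [hA, hM₀, inputMemory, (hd i).2.1]
  have hx : ∀ i : Fin m, I.x i = A 2 i := fun i => by simp [hA, hM₀, inputMemory, (hd i).2.2.1]
  have hy : ∀ i : Fin m, I.y i = A 3 i := fun i => by simp [hA, hM₀, inputMemory, (hd i).2.2.2]
  have hms : m ≤ s := (le_inputSize d n ε).trans hs
  have hAs : ∀ a i, width (A a i) ≤ s := fun a i => ((bounded_inputMemory d n ε).2 a i).trans hs
  have hpriority : ∀ i : Fin m,
      I.agentPriority i = ((A 3 i - A 1 i / A 0 i : ℚ) : ℝ) := fun i => by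
    rw [Instance.agentPriority, hp, hc, hy]
    push_cast
    rfl
  have hkW : keyWidth s + 1 ≤ (s + 1) * (keyWidth s + 1) :=
    Nat.le_mul_of_pos_left _ (Nat.succ_pos s)
  have hmW : m * (keyWidth s + 1) ≤ (s + 1) * (keyWidth s + 1) :=
    Nat.mul_le_mul_right _ (hms.trans (Nat.le_succ s))
  have hr := rounds_mono hms
  have hB : M₀.Bounded (memoryWidth s) := by
    have hsW : inputSize d n ε ≤ memoryWidth s := by
      unfold memoryWidth
      unfold keyWidth at *
      omega
    exact ⟨fun k => ((bounded_inputMemory d n ε).1 k).trans hsW,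
      fun a i => ((bounded_inputMemory d n ε).2 a i).trans hsW⟩
  have hexec := exec_delegationProgram (w := delegationProgram.weight) (W := memoryWidth s)
    (M := M₀) (m := m) (n := n) (v := keyWidth s)
    (by simp [hM₀, inputMemory]) (by simp [hM₀, inputMemory]) (by simp [hM₀, inputMemory])
    (by unfold memoryWidth; unfold keyWidth at *; omega)
    (by unfold memoryWidth thresholdWidth; omega)
    (by unfold keyWidth; omega) (by unfold memoryWidth; omega) (by unfold memoryWidth; omega)
    (fun k hk i _ => (width_key_le hAs _ i).trans
      (Nat.add_le_add_left (width_threshold_le n hAs hms hk) _))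
    (fun k hk => (width_threshold_le n hAs hms hk).trans (by unfold memoryWidth; omega))
    ((width_increment_le n hAs hms).trans (by unfold memoryWidth thresholdWidth; omega))
    (fun i _ => by
      have h1 := width_sub_le (A 3 i) (A 1 i / A 0 i)
      have h2 := width_div_le (A 1 i) (A 0 i)
      have h3 := hAs 0 i
      have h4 := hAs 1 i
      have h5 := hAs 3 i
      have h6 : 3 * s + 2 ≤ keyWidth s := Nat.le_add_right _ _
      refine h1.trans ?_
      unfold memoryWidth
      omega)
    (fun i hi => by
      have := I.agentPriority_nonneg ⟨i, hi⟩
      rw [hpriority] at this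
      exact_mod_cast this)
  obtain ⟨M, t, hrun, ht, -, h0, hout⟩ := hexec le_rfl hB
  obtain ⟨l, hnodup, hlT, hpair, hlen, hrank⟩ := exists_list_rank
    (fun i => A 3 i - A 1 i / A 0 i) (lt_of_mem_selected (A := A) (m := m) (n := n))
  refine ⟨M, t, _, l, hrun, ht.trans (Nat.mul_le_mul_right _ (delegationSteps_mono hms)), ⟨?_, ?_⟩,
    ⟨hnodup, hlT, ?_⟩, I.attains_selected n hp hc hx hρ⟩
  · rw [h0, hlen]
    rfl
  · intro k hk
    obtain ⟨h1, h2⟩ := hrank k hk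
    have := hout _ h1
    rw [← this]
    exact congrArg (M.arr 0) h2.symm
  · refine hpair.imp fun {i j} h => ?_
    rw [hpriority, hpriority]
    exact_mod_cast h

theorem half_mul_one_sub_inv_exp_le : 1 / 2 * (1 - 1 / Real.exp 1) ≤ (1 / 3 : ℝ) := by
  have h1 : Real.exp 1 < 3 := Real.exp_one_lt_d9.trans (by norm_num)
  have h2 : 1 / 3 ≤ 1 / Real.exp 1 := one_div_le_one_div_of_le (Real.exp_pos 1) h1.le
  linarith

end DelegatedSearch

/-- In the binary model where at most `n` options may be examined: (1) some single-proposal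
mechanism attains the fraction `(1/2)(1 - 1/e)` of the expected net value of the optimal search;
(2) there is a program that, given a rational instance, `n`, and a rational `ε > 0`, computes, in
time polynomial in the bit length of the input and in `1/ε`, the eligible set `R` of a
single-proposal mechanism that attains the fraction `(1/2)(1 - 1/e - ε)`, listed in an order in
which the agent examines it in a best response. -/
theorem theorem0p316 :
    (∀ (m n : ℕ) (I : DelegatedSearch.Instance m),
      ∃ R : Finset (Fin m), I.Attains n R (1 / 2 * (1 - 1 / Real.exp 1))) ∧
    (∃ (P : DelegatedSearch.Program) (T : Polynomial ℕ),
      ∀ (m n : ℕ) (ε : ℚ) (I : DelegatedSearch.Instance m) (d : DelegatedSearch.RationalData m),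
        0 < ε → d.Describes I →
        ∃ (M : DelegatedSearch.Memory) (t : ℕ) (R : Finset (Fin m)) (l : List (Fin m)),
          DelegatedSearch.Runs P (DelegatedSearch.inputMemory d n ε) M t ∧
          t ≤ T.eval (DelegatedSearch.inputSize d n ε + ⌈1 / ε⌉₊) ∧
          M.Outputs l ∧ I.IsPriorityOrder R l ∧
          I.Attains n R (1 / 2 * (1 - 1 / Real.exp 1 - (ε : ℝ)))) := by
  refine ⟨fun m n I => I.exists_attains_half n
    (DelegatedSearch.half_mul_one_sub_inv_exp_le.trans (by norm_num)), ?_⟩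
  obtain ⟨T, hT⟩ := DelegatedSearch.isPolynomial_runningTime
  refine ⟨DelegatedSearch.delegationProgram, T, fun m n ε I d hε hd => ?_⟩
  have hε' : (0 : ℝ) < ε := by exact_mod_cast hε
  have hρ := DelegatedSearch.half_mul_one_sub_inv_exp_le
  rw [hT]
  exact DelegatedSearch.exists_runs_delegationProgram n ε I d hd (Nat.le_add_right _ _)
    (by linarith)
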